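/- Let $\mathcal K=\mathcal K^1\times\dots\times\mathcal K^r$, where each $\mathcal K^j$ is a nonempty closed convex cone in a finite-dimensional real inner product space, let $\mathcal A$ be a linear map from the product space to a finite-dimensional inner product space, and let $c$ be a vector. For $b$ in the target space consider $$(P)\ \inf\{\langle c,x\rangle : \mathcal A x=b,\ x\in\mathcal K^*\},\qquad (D)\ \sup\{\langle b,y\rangle : c-\mathcal A^{T}y\in\mathcal K\},$$ with optimal values in $[-\infty,+\infty]$ (infeasible: $+\infty$ for $(P)$, $-\infty$ for $(D)$). Let $\mathcal F_{\min}^D$ be the smallest face of $\mathcal K$ containing the feasible slacks $\{c-\mathcal A^Ty\in\mathcal K\}$; it is $\emptyset$ iff $(D)$ is infeasible. The distance to polyhedrality $\mathrm{dist}_P(\mathcal C)$ of a closed convex cone $\mathcal C$ is the largest $n$ for which there is a chain $\mathcal F_0\subsetneq\dots\subsetneq\mathcal F_n$ of nonempty faces of $\mathcal C$ with $\mathcal F_0$ polyhedral and $\mathcal F_1,\dots,\mathcal F_n$ not polyhedral. Put $N=\sum_{j=1}^r\mathrm{dist}_P(\mathcal K^j)$. *Facial reduction.* Starting with $\mathcal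 F_1=\mathcal K$, the generic algorithm picks at the face $\mathcal F_i$ a direction $d_i\in\mathcal F_i^*\cap\ker\mathcal A$ such that either (i) $d_i\notin\mathcal F_i^\perp$ and $\langle c,d_i\rangle=0$, and then it sets $\mathcal F_{i+1}=\mathcal F_i\cap\{d_i\}^\perp$ and continues, or (ii) $\langle c,d_i\rangle<0$, and then it stops with final face $\emptyset$. It stops with final face $\mathcal F_i$ if there is no such direction. The number of steps is the number of directions found. The singularity degree $d(D)$ is the minimum number of directions in an output of this algorithm. The distance to strong duality is the minimum $\ell$ such that $\ell$ steps of type (i) can lead to a face $\mathcal F_{\ell+1}$ that *restores strong duality*: the value of $(\hat P)\ \inf\{\langle c,x\rangle:\mathcal Ax=b,\ x\in\mathcal F_{\ell+1}^*\}$ equals that of $(D)$, and it is attained if that value is finite. *Auxiliary problems.* For a cone $\mathcal C$ and vectors $e,e^*$, $$(P_{\mathcal C})\ \min\{t : -\langle c,x-te^*\rangle+t-w=0,\ \langle e,x\rangle+w=1,\ \mathcal A x-t\mathcal A e^*=0,\ (x,t,w)\in\mathcal C^*\times\mathbb R_+\times\mathbb R_+\},$$ $$(D_{\mathcal C})\ \max\{y_2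 : cy_1-ey_2-\mathcal A^Ty_3\in\mathcal C,\ \sigma:=1-y_1(1+\langle c,e^*\rangle)+\langle e^*,\mathcal A^Ty_3\rangle\ge 0,\ y_1-y_2\ge 0\}.$$ Optimal solutions are strictly complementary if $t=y_2$, $cy_1-ey_2-\mathcal A^Ty_3\in\mathrm{ri}(\mathcal C\cap\{x\}^\perp)$, $t+\sigma>0$ and $w+y_1-y_2>0$. *FRA-Poly, Phase 1.* Start with $\mathcal F=\mathcal K$. At a face $\mathcal F=\mathcal F^1\times\dots\times\mathcal F^r$, take any $e^*\in\mathrm{ri}\,\mathcal F^*$ and any $e$ with $e_j=0$ if $\mathcal F^j$ is polyhedral and $e_j\in\mathrm{ri}\,\mathcal F^j$ otherwise, and any optimal solutions of $(P_{\mathcal F}),(D_{\mathcal F})$. If $t=0$ and $\langle c,x\rangle<0$, record $x$ and stop with final face $\emptyset$. If $t=0$ and $\langle c,x\rangle=0$, record $x$, replace $\mathcal F$ by $\mathcal F\cap\{x\}^\perp$ and repeat. If $t>0$, stop with $\mathcal F$ and $s'=c-\mathcal A^T(y_3/y_1)$. *Phase 2* (after the last case). Let $\hat{\mathcal K}$ be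 the product of the cones $\mathcal F^j$ ($\mathcal F^j$ polyhedral) and $\mathrm{span}\,\mathcal F^j$ (otherwise). Take any $e\in\mathrm{ri}\,\hat{\mathcal K}$, $e^*\in\mathrm{ri}\,\hat{\mathcal K}^*$ and strictly complementary optimal solutions of $(P_{\hat{\mathcal K}}),(D_{\hat{\mathcal K}})$. If $t=0$, record $x$ and return $\mathcal F\cap\{x\}^\perp$; if $t>0$, return $\mathcal F$. **Theorem.** Whether $(D)$ is feasible or not: 1. FRA-Poly is well defined and terminates. At every face reached in Phase 1 admissible $e,e^*$ exist, for each such choice both auxiliary problems have optimal solutions, every pair of them falls under one of the three cases, and Phase 1 performs at most $N$ replacements of the face. In Phase 2 admissible $e,e^*$ exist, for each such choice strictly complementary solutions exist, and, for $\tilde s=c-\mathcal A^T(y_3/y_1)$, some convex combination of $\tilde s$ and $s'$ is a feasible slack in the relative interior of the returned face. 2. Complete runs exist. Every complete run returns $\mathcal F_{\min}^D$ after at most $1+N$ facial reduction steps, and its directions are an output of the generic algorithm. Hence $d(D)\le 1+N$. 3. If Phase 1 stops with a face $\mathcal F$ and $s'$, then $(D)$ is feasible, $\mathcal F_{\min}^D\subseteq\mathcal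 F$, $s'$ is a feasible slack in $\mathcal F$ with $s'_j\in\mathrm{ri}\,\mathcal F^j$ for every nonpolyhedral $\mathcal F^j$, and $\mathcal F$ (reached in at most $N$ steps) restores strong duality for every $b$. 4. If Phase 1 stops with $\langle c,x\rangle<0$ at a face $\mathcal F$ (reached in at most $N$ steps), then $(D)$ is infeasible, and $\mathcal F$ restores strong duality for every $b$ for which $\mathcal Ax=b$ has a solution in $\mathcal F^*$. 5. For every $b$ such that $(P)$ or $(D)$ is feasible, the distance to strong duality is at most $N$. -/

import Mathlib

open scoped RealInnerProductSpace

noncomputable section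

namespace FacialReduction

/-! ### Cones, faces and the distance to polyhedrality -/

section Cones

variable {X : Type*} [NormedAddCommGroup X] [InnerProductSpace ℝ X]

/-- The dual cone `U* = {x | ⟪s, x⟫ ≥ 0 for all s ∈ U}`. -/
def dualCone (U : Set X) : Set X := (PointedCone.dual (innerₗ X) U : Set X)

/-- The orthogonal complement `U⊥`, as a set. -/
def perp (U : Set X) : Set X := {x | ∀ s ∈ U, ⟪s, x⟫ = 0}

/-- `F` is a face of the convex set `C`: a convex subset that contains both end points of every
segment of `C` whose relative interior it meets. The empty set is a face. -/
def IsFace (C F : Set X) : Prop := IsExtreme ℝ C F ∧ Convex ℝ F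

/-- The smallest face of `C` that contains `S` (for `S ⊆ C`); it is empty if `S` is empty. -/
def minFace (C S : Set X) : Set X := ⋂₀ {F | IsFace C F ∧ S ⊆ F}

/-- A polyhedral cone: the intersection of finitely many closed half-spaces through the origin. -/
def IsPolyhedral (C : Set X) : Prop := ∃ T : Finset X, C = {x | ∀ a ∈ T, 0 ≤ ⟪a, x⟫}

/-- There is a chain `F 0 ⊊ F 1 ⊊ … ⊊ F n` of nonempty faces of `C` (so, of length `n + 1`) in which
`F 0` is the only polyhedral face. -/
def HasPolyChain (C : Set X) (n : ℕ) : Prop :=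
  ∃ F : Fin (n + 1) → Set X, StrictMono F ∧ (∀ i, IsFace C (F i) ∧ (F i).Nonempty) ∧
    IsPolyhedral (F 0) ∧ ∀ i, i ≠ 0 → ¬ IsPolyhedral (F i)

/-- The distance to polyhedrality: the largest length, minus one, of such a chain. For a closed convex
cone in a finite dimensional space the lineality space is a chain with `n = 0`, and `n` never exceeds
the dimension, since the dimensions of the faces in a chain increase strictly. -/
def distPoly (C : Set X) : ℕ := sSup {n | HasPolyChain C n}

end Cones

/-! ### The conic programs (P) and (D), and generic facial reduction -/

section Conic

variable {X Y : Type*} [NormedAddCommGroup X] [InnerProductSpace ℝ X] [FiniteDimensional ℝ X]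
  [NormedAddCommGroup Y] [InnerProductSpace ℝ Y] [FiniteDimensional ℝ Y]

/-- The adjoint (transpose) of `A`. -/
abbrev adj (A : X →ₗ[ℝ] Y) : Y →ₗ[ℝ] X := LinearMap.adjoint A

/-- The feasible slacks of (D): the elements of `K` of the form `c - Aᵀ y`. -/
def slacks (A : X →ₗ[ℝ] Y) (c : X) (K : Set X) : Set X := {s | s ∈ K ∧ ∃ y, s = c - adj A y}

/-- The feasible set of the primal problem `inf {⟪c, x⟫ | A x = b, x ∈ F*}`. -/
def primalFeasible (A : X →ₗ[ℝ] Y) (b : Y) (F : Set X) : Set X := {x | A x = b ∧ x ∈ dualCone F}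

/-- The optimal value of `inf {⟪c, x⟫ | A x = b, x ∈ F*}`; it is `⊤` if the problem is infeasible. -/
def primalValue (A : X →ₗ[ℝ] Y) (b : Y) (c : X) (F : Set X) : EReal :=
  ⨅ x ∈ primalFeasible A b F, ((⟪c, x⟫ : ℝ) : EReal)

/-- The optimal value of `sup {⟪b, y⟫ | c - Aᵀ y ∈ K}`; it is `⊥` if the problem is infeasible. -/
def dualValue (A : X →ₗ[ℝ] Y) (b : Y) (c : X) (K : Set X) : EReal :=
  ⨆ y ∈ {y : Y | c - adj A y ∈ K}, ((⟪b, y⟫ : ℝ) : EReal)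

/-- Replacing `K*` by `F*` in (P) closes the gap to the value of (D), and the new primal problem has
an optimal solution whenever the value of (D) is finite. -/
def StrongDualityRestored (A : X →ₗ[ℝ] Y) (b : Y) (c : X) (K F : Set X) : Prop :=
  primalValue A b c F = dualValue A b c K ∧
    (dualValue A b c K ≠ ⊥ → dualValue A b c K ≠ ⊤ →
      ∃ x ∈ primalFeasible A b F, ((⟪c, x⟫ : ℝ) : EReal) = primalValue A b c F)

/-- A reducing direction at `F` that exposes a proper face of `F` containing the feasible slacks. -/
def IsProperDirection (A : X →ₗ[ℝ] Y) (c : X) (F : Set X) (d : X) : Prop :=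
  d ∈ dualCone F ∧ A d = 0 ∧ d ∉ perp F ∧ ⟪c, d⟫ = 0

/-- A reducing direction at `F` that certifies infeasibility. -/
def IsInfeasDirection (A : X →ₗ[ℝ] Y) (c : X) (F : Set X) (d : X) : Prop :=
  d ∈ dualCone F ∧ A d = 0 ∧ ⟪c, d⟫ < 0

/-- `ReducesTo A c K ds F`: starting at `K`, successive facial reduction steps with the directions
`ds` lead to the face `F = K ∩ {d₁}⊥ ∩ … ∩ {d_ℓ}⊥`. -/
inductive ReducesTo (A : X →ₗ[ℝ] Y) (c : X) (K : Set X) : List X → Set X → Prop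
  | start : ReducesTo A c K [] K
  | step {ds : List X} {F : Set X} {d : X} : ReducesTo A c K ds F → IsProperDirection A c F d →
      ReducesTo A c K (ds ++ [d]) (F ∩ perp {d})

/-- The possible outputs (directions and final face) of the generic facial reduction algorithm. -/
inductive GenericOutput (A : X →ₗ[ℝ] Y) (c : X) (K : Set X) : List X → Set X → Prop
  | minimal {ds : List X} {F : Set X} : ReducesTo A c K ds F →
      (¬ ∃ d, IsProperDirection A c F d ∨ IsInfeasDirection A c F d) → GenericOutput A c K ds F
  | infeasible {ds : List X} {F : Set X} {d : X} : ReducesTo A c K ds F →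
      IsInfeasDirection A c F d → GenericOutput A c K (ds ++ [d]) ∅

/-- The singularity degree `d(D)`: the least number of directions in an output of the generic facial
reduction algorithm. -/
def singularityDegree (A : X →ₗ[ℝ] Y) (c : X) (K : Set X) : ℕ∞ :=
  ⨅ (ds : List X) (_ : ∃ G, GenericOutput A c K ds G), (ds.length : ℕ∞)

/-- The distance to strong duality: the least number of facial reduction steps that restore strong
duality. -/
def distStrongDuality (A : X →ₗ[ℝ] Y) (b : Y) (c : X) (K : Set X) : ℕ∞ :=
  ⨅ (ds : List X) (_ : ∃ F, ReducesTo A c K ds F ∧ StrongDualityRestored A b c K F),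
    (ds.length : ℕ∞)

/-! ### The auxiliary pair of problems that produces reducing directions -/

/-- A point `(x, t, w)` of the auxiliary primal and a point `(y₁, y₂, y₃)` of the auxiliary dual. -/
structure AuxPoint (X Y : Type*) where
  x : X
  t : ℝ
  w : ℝ
  y₁ : ℝ
  y₂ : ℝ
  y₃ : Y

/-- Feasibility for the auxiliary primal: minimize `t`. -/
def AuxPrimalFeasible (A : X →ₗ[ℝ] Y) (c : X) (K : Set X) (e es x : X) (t w : ℝ) : Prop :=
  -⟪c, x - t • es⟫ + t - w = 0 ∧ ⟪e, x⟫ + w = 1 ∧ A x - t • A es = 0 ∧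
    x ∈ dualCone K ∧ 0 ≤ t ∧ 0 ≤ w

/-- Feasibility for the auxiliary dual: maximize `y₂`. -/
def AuxDualFeasible (A : X →ₗ[ℝ] Y) (c : X) (K : Set X) (e es : X) (y₁ y₂ : ℝ) (y₃ : Y) : Prop :=
  y₁ • c - y₂ • e - adj A y₃ ∈ K ∧ 0 ≤ 1 - y₁ * (1 + ⟪c, es⟫) + ⟪es, adj A y₃⟫ ∧ 0 ≤ y₁ - y₂

/-- `q` is a pair of optimal solutions of the two auxiliary problems. -/
def IsAuxOptimal (A : X →ₗ[ℝ] Y) (c : X) (K : Set X) (e es : X) (q : AuxPoint X Y) : Prop :=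
  AuxPrimalFeasible A c K e es q.x q.t q.w ∧
  (∀ x t w, AuxPrimalFeasible A c K e es x t w → q.t ≤ t) ∧
  AuxDualFeasible A c K e es q.y₁ q.y₂ q.y₃ ∧
  (∀ y₁ y₂ y₃, AuxDualFeasible A c K e es y₁ y₂ y₃ → y₂ ≤ q.y₂)

/-- `q` is a pair of optimal solutions that satisfies (dual) strict complementarity. -/
def IsAuxStrict (A : X →ₗ[ℝ] Y) (c : X) (K : Set X) (e es : X) (q : AuxPoint X Y) : Prop :=
  IsAuxOptimal A c K e es q ∧ q.t = q.y₂ ∧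
  q.y₁ • c - q.y₂ • e - adj A q.y₃ ∈ intrinsicInterior ℝ (K ∩ perp {q.x}) ∧
  0 < q.t + (1 - q.y₁ * (1 + ⟪c, es⟫) + ⟪es, adj A q.y₃⟫) ∧
  0 < q.w + (q.y₁ - q.y₂)

/-- The vector `c - Aᵀ (y₃ / y₁)`. -/
def auxSlack (A : X →ₗ[ℝ] Y) (c : X) (q : AuxPoint X Y) : X := c - adj A (q.y₁⁻¹ • q.y₃)

end Conic

/-! ### FRA-Poly -/

section Poly

variable {r : ℕ} {E : Fin r → Type*} [∀ j, NormedAddCommGroup (E j)]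
  [∀ j, InnerProductSpace ℝ (E j)] [∀ j, FiniteDimensional ℝ (E j)]
  {Y : Type*} [NormedAddCommGroup Y] [InnerProductSpace ℝ Y] [FiniteDimensional ℝ Y]

/-- The product cone `K¹ × … × Kʳ`. -/
def prodCone (K : ∀ j, ProperCone ℝ (E j)) : Set (PiLp 2 E) := {x | ∀ j, x j ∈ K j}

/-- The `j`-th block `Fʲ` of a product `F = F¹ × … × Fʳ`. -/
def block (F : Set (PiLp 2 E)) (j : Fin r) : Set (E j) := (fun x : PiLp 2 E => x j) '' F

/-- The admissible choices of `e` and `e*` in Phase 1 at the face `F`. -/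
def Phase1Params (F : Set (PiLp 2 E)) (e es : PiLp 2 E) : Prop :=
  es ∈ intrinsicInterior ℝ (dualCone F) ∧
  ∀ j, (IsPolyhedral (block F j) → e j = 0) ∧
    (¬ IsPolyhedral (block F j) → e j ∈ intrinsicInterior ℝ (block F j))

/-- `q` may be obtained by solving the auxiliary pair in Phase 1 at the face `F`. -/
def Phase1Solution (A : PiLp 2 E →ₗ[ℝ] Y) (c : PiLp 2 E) (F : Set (PiLp 2 E))
    (q : AuxPoint (PiLp 2 E) Y) : Prop :=
  ∃ e es, Phase1Params F e es ∧ IsAuxOptimal A c F e es q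

/-- `Phase1Reaches A c K ds F`: Phase 1, started at `K`, can be at the face `F` after finding the
directions `ds` (without having stopped yet). -/
inductive Phase1Reaches (A : PiLp 2 E →ₗ[ℝ] Y) (c : PiLp 2 E) (K : Set (PiLp 2 E)) :
    List (PiLp 2 E) → Set (PiLp 2 E) → Prop
  | start : Phase1Reaches A c K [] K
  | step {ds : List (PiLp 2 E)} {F : Set (PiLp 2 E)} {q : AuxPoint (PiLp 2 E) Y} :
      Phase1Reaches A c K ds F → Phase1Solution A c F q → q.t = 0 → ⟪c, q.x⟫ = 0 →
      Phase1Reaches A c K (ds ++ [q.x]) (F ∩ perp {q.x})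

/-- Phase 1 can stop by declaring (D) infeasible: `F` is its last face, reached with the directions
`ds`, and `d` is the additional direction that it finds there. -/
def Phase1StopsInfeasible (A : PiLp 2 E →ₗ[ℝ] Y) (c : PiLp 2 E) (K : Set (PiLp 2 E))
    (ds : List (PiLp 2 E)) (F : Set (PiLp 2 E)) (d : PiLp 2 E) : Prop :=
  Phase1Reaches A c K ds F ∧
    ∃ q, Phase1Solution A c F q ∧ q.t = 0 ∧ ⟪c, q.x⟫ < 0 ∧ d = q.x

/-- Phase 1 can stop with the directions `ds`, the face `F` and the vector `s'` as its output. -/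
def Phase1StopsFeasible (A : PiLp 2 E →ₗ[ℝ] Y) (c : PiLp 2 E) (K : Set (PiLp 2 E))
    (ds : List (PiLp 2 E)) (F : Set (PiLp 2 E)) (s' : PiLp 2 E) : Prop :=
  Phase1Reaches A c K ds F ∧ ∃ q, Phase1Solution A c F q ∧ 0 < q.t ∧ s' = auxSlack A c q

/-- `s` is a feasible slack for the face `F` for which the partial polyhedral Slater condition holds:
it lies in the relative interior of every nonpolyhedral block. -/
def IsPPSSlack (A : PiLp 2 E →ₗ[ℝ] Y) (c : PiLp 2 E) (F : Set (PiLp 2 E)) (s : PiLp 2 E) : Prop :=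
  s ∈ slacks A c F ∧ ∀ j, ¬ IsPolyhedral (block F j) → s j ∈ intrinsicInterior ℝ (block F j)

/-- The cone used in Phase 2: each nonpolyhedral block of `F` is replaced by its span. -/
def relaxedCone (F : Set (PiLp 2 E)) : Set (PiLp 2 E) :=
  {x | ∀ j, (IsPolyhedral (block F j) → x j ∈ block F j) ∧
    (¬ IsPolyhedral (block F j) → x j ∈ Submodule.span ℝ (block F j))}

/-- The admissible choices of `e` and `e*` in Phase 2. -/
def Phase2Params (F : Set (PiLp 2 E)) (e es : PiLp 2 E) : Prop :=
  e ∈ intrinsicInterior ℝ (relaxedCone F) ∧ es ∈ intrinsicInterior ℝ (dualCone (relaxedCone F))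

/-- `q` may be obtained by solving the auxiliary pair in Phase 2. -/
def Phase2Solution (A : PiLp 2 E →ₗ[ℝ] Y) (c : PiLp 2 E) (F : Set (PiLp 2 E))
    (q : AuxPoint (PiLp 2 E) Y) : Prop :=
  ∃ e es, Phase2Params F e es ∧ IsAuxStrict A c (relaxedCone F) e es q

/-- `Phase2Output A c ds F q ds' G`: if Phase 1 has stopped with the directions `ds` and the face `F`,
and `q` is the solution found in Phase 2, then `ds'` are all directions found and `G` is the final
face. -/
inductive Phase2Output (ds : List (PiLp 2 E)) (F : Set (PiLp 2 E)) (q : AuxPoint (PiLp 2 E) Y) :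
    List (PiLp 2 E) → Set (PiLp 2 E) → Prop
  | reduce : q.t = 0 → Phase2Output ds F q (ds ++ [q.x]) (F ∩ perp {q.x})
  | keep : 0 < q.t → Phase2Output ds F q ds F

/-- The possible outputs of a complete run of FRA-Poly: all directions found and the final face. -/
inductive FRAPolyOutput (A : PiLp 2 E →ₗ[ℝ] Y) (c : PiLp 2 E) (K : Set (PiLp 2 E)) :
    List (PiLp 2 E) → Set (PiLp 2 E) → Prop
  | infeasible {ds : List (PiLp 2 E)} {F : Set (PiLp 2 E)} {d : PiLp 2 E} :
      Phase1StopsInfeasible A c K ds F d → FRAPolyOutput A c K (ds ++ [d]) ∅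
  | feasible {ds ds' : List (PiLp 2 E)} {F G : Set (PiLp 2 E)} {s' : PiLp 2 E}
      {q : AuxPoint (PiLp 2 E) Y} :
      Phase1StopsFeasible A c K ds F s' → Phase2Solution A c F q → Phase2Output ds F q ds' G →
      FRAPolyOutput A c K ds' G

end Poly

end FacialReduction

end

/-!
# Facial reduction that exploits polyhedral faces

Everything rests on one duality theorem, `farkas_of_isSlaterPoint`: a linear functional that is
nonnegative on the solutions of a system `B z ∈ F`, `a i z ≥ 0` is a combination of these constraints,
provided that some solution `z₀` has the partial polyhedral Slater property, that is,
`F` is the intersection of a polyhedral cone and a cone `C` with `B z₀` in the relative interior of `C`.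
To prove it, the solutions are restricted to those that `B` maps into the span of `C`, a polyhedral
condition, under which `B z₀` becomes an interior point. The Hahn-Banach theorem then gives a multiplier
for `C`, and the remaining inequality over a polyhedral cone is settled by the finite Farkas lemma,
which is proved for arbitrary vector spaces (`farkas`).

Homogenizing the programs turns this theorem into strong duality with primal attainment at a Slater
slack (`strongDualityRestored_of_isSlaterPoint`), and into the solvability of the auxiliary pair without
a duality gap (`exists_isAuxOptimal`), for which `(0, -1, 0)` and the normalized `(e*, 1, 1)` are Slater
points. Over a polyhedral cone Tucker's theorem supplies strictly complementary solutions
(`exists_isAuxStrict`).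

In Phase 1 a solution with `t = 0` and `⟪c, x⟫ = 0` satisfies `⟪e, x⟫ = 1`. As `e` vanishes in the
polyhedral blocks, `x` exposes a proper face of some nonpolyhedral block, and the distance to
polyhedrality of that block drops (`distPoly_lt`, `phase1_step`); this bounds the number of steps. A
solution with `t > 0` has `y₂ = t > 0`, and the slack `c - Aᵀ (y₃ / y₁)` exceeds an element of the face by
a positive multiple of `e`, which makes it a Slater slack. In Phase 2 (`phase2_spec`) the relaxed cone is
polyhedral. By strict complementarity its slack is in the relative interior of each polyhedral block of
the final face, and in the span of the other blocks, where `s'` is a relative interior point; so a convex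
combination of the two is in the relative interior of the final face, which is therefore the minimal one.
-/

noncomputable section

namespace FacialReduction

/-! ### Finite systems of linear inequalities -/

section Farkas

variable {Z : Type*} [AddCommGroup Z] [Module ℝ Z]

/-- The finite Farkas lemma over an arbitrary vector space. The induction step projects along a
point `z₀` at which the last functional is the only one that is negative. -/
theorem farkas_fin (n : ℕ) (a : Fin n → Z →ₗ[ℝ] ℝ) (φ : Z →ₗ[ℝ] ℝ)
    (h : ∀ z, (∀ i, 0 ≤ a i z) → 0 ≤ φ z) :
    ∃ l : Fin n → ℝ, (∀ i, 0 ≤ l i) ∧ ∀ z, φ z = ∑ i, l i * a i z := by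
  induction n generalizing φ with
  | zero =>
    refine ⟨0, fun i => i.elim0, fun z => ?_⟩
    have h1 := h z (fun i => i.elim0)
    have h2 := h (-z) (fun i => i.elim0)
    rw [map_neg] at h2
    simpa using le_antisymm (by linarith) h1
  | succ n ih =>
    by_cases hlast : ∀ z, (∀ i : Fin n, 0 ≤ a i.castSucc z) → 0 ≤ φ z
    · obtain ⟨l, hl, hφ⟩ := ih (fun i => a i.castSucc) φ hlast
      refine ⟨Fin.snoc l 0, fun i => ?_, fun z => ?_⟩
      · refine Fin.lastCases (by simp) (fun j => by simpa using hl j) i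
      · simp [Fin.sum_univ_castSucc, hφ z]
    · push Not at hlast
      obtain ⟨z₁, hz₁, hφ₁⟩ := hlast
      have ha₁ : a (Fin.last n) z₁ < 0 := by
        by_contra hc
        push Not at hc
        exact absurd (h z₁ (fun i => Fin.lastCases hc hz₁ i)) (not_le.2 hφ₁)
      -- normalized so that the last functional takes the value `-1`
      set z₀ : Z := (-(a (Fin.last n) z₁))⁻¹ • z₁ with hz₀
      have hpos : 0 < (-(a (Fin.last n) z₁))⁻¹ := inv_pos.2 (by linarith)
      have h0 : a (Fin.last n) z₀ = -1 := by
        rw [hz₀, map_smul, smul_eq_mul, inv_neg, neg_mul, inv_mul_cancel₀ ha₁.ne]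
      have h0' : ∀ i : Fin n, 0 ≤ a i.castSucc z₀ := fun i => by
        rw [hz₀, map_smul, smul_eq_mul]
        exact mul_nonneg hpos.le (hz₁ i)
      have hφ0 : φ z₀ < 0 := by
        rw [hz₀, map_smul, smul_eq_mul]
        exact mul_neg_of_pos_of_neg hpos hφ₁
      let P : Z →ₗ[ℝ] Z := LinearMap.id + (a (Fin.last n)).smulRight z₀
      have hP : ∀ z, P z = z + a (Fin.last n) z • z₀ := fun z => by simp [P]
      obtain ⟨l, hl, hφ⟩ := ih (fun i => (a i.castSucc).comp P) (φ.comp P) (fun z hz => by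
        refine h (P z) (fun i => Fin.lastCases ?_ hz i)
        rw [hP, map_add, map_smul, smul_eq_mul, h0]
        simp)
      refine ⟨Fin.snoc l (∑ i, l i * a i.castSucc z₀ - φ z₀), fun i => ?_, fun z => ?_⟩
      · refine Fin.lastCases ?_ (fun j => by simpa using hl j) i
        have : 0 ≤ ∑ i, l i * a i.castSucc z₀ :=
          Finset.sum_nonneg fun i _ => mul_nonneg (hl i) (h0' i)
        simp only [Fin.snoc_last]
        linarith
      · have := hφ z
        simp only [LinearMap.comp_apply, hP, map_add, map_smul, smul_eq_mul, mul_add,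
          Finset.sum_add_distrib] at this
        have h3 : ∑ i, l i * (a (Fin.last n) z * a i.castSucc z₀)
            = a (Fin.last n) z * ∑ i, l i * a i.castSucc z₀ := by
          rw [Finset.mul_sum]
          exact Finset.sum_congr rfl fun i _ => by ring
        simp only [Fin.sum_univ_castSucc, Fin.snoc_castSucc, Fin.snoc_last]
        rw [h3] at this
        linarith

theorem farkas {ι : Type*} [Fintype ι] (a : ι → Z →ₗ[ℝ] ℝ) (φ : Z →ₗ[ℝ] ℝ)
    (h : ∀ z, (∀ i, 0 ≤ a i z) → 0 ≤ φ z) :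
    ∃ l : ι → ℝ, (∀ i, 0 ≤ l i) ∧ ∀ z, φ z = ∑ i, l i * a i z := by
  let f := Fintype.equivFin ι
  obtain ⟨l, hl, hφ⟩ := farkas_fin (Fintype.card ι) (fun i => a (f.symm i)) φ
    (fun z hz => h z fun i => by simpa using hz (f i))
  refine ⟨fun i => l (f i), fun i => hl _, fun z => ?_⟩
  rw [hφ z]
  exact (Fintype.sum_equiv f _ _ fun i => by simp).symm

/-- The finite Farkas lemma with additional equality constraints. -/
theorem farkas_of_eq {ι V : Type*} [Fintype ι] [AddCommGroup V] [Module ℝ V]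
    (a : ι → Z →ₗ[ℝ] ℝ) (M : Z →ₗ[ℝ] V) (φ : Z →ₗ[ℝ] ℝ)
    (h : ∀ z, M z = 0 → (∀ i, 0 ≤ a i z) → 0 ≤ φ z) :
    ∃ l : ι → ℝ, (∀ i, 0 ≤ l i) ∧ ∃ ψ : V →ₗ[ℝ] ℝ, ∀ z, φ z = ∑ i, l i * a i z + ψ (M z) := by
  obtain ⟨l, hl, hφ⟩ := farkas (Z := LinearMap.ker M) (fun i => (a i).domRestrict _)
    (φ.domRestrict _) (fun z hz => h z z.2 hz)
  -- the remainder vanishes on the kernel of `M`, hence factors through `M`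
  have hmem : φ - ∑ i, l i • a i ∈ (LinearMap.ker M).dualAnnihilator := by
    rw [Submodule.mem_dualAnnihilator]
    intro z hz
    have := hφ ⟨z, hz⟩
    simp only [LinearMap.domRestrict_apply] at this
    simp [this, LinearMap.sum_apply]
  rw [← LinearMap.range_dualMap_eq_dualAnnihilator_ker] at hmem
  obtain ⟨ψ, hψ⟩ := hmem
  refine ⟨l, hl, ψ, fun z => ?_⟩
  have := LinearMap.congr_fun hψ z
  simp [LinearMap.sum_apply] at this
  rw [this]
  ring

/-- Tucker's theorem: a system of linear inequalities and the system of its linear dependencies have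
strictly complementary solutions. -/
theorem tucker {ι : Type*} [Fintype ι] (a : ι → Z →ₗ[ℝ] ℝ) :
    ∃ z, (∀ i, 0 ≤ a i z) ∧ ∃ l : ι → ℝ, (∀ i, 0 ≤ l i) ∧ (∀ u, ∑ i, l i * a i u = 0) ∧
      ∀ i, 0 < l i + a i z := by
  classical
  have key : ∀ i, ∃ z, ∃ l : ι → ℝ, (∀ k, 0 ≤ a k z) ∧ (∀ k, 0 ≤ l k) ∧
      (∀ u, ∑ k, l k * a k u = 0) ∧ 0 < l i + a i z := by
    intro i
    by_cases hi : ∃ z, (∀ k, 0 ≤ a k z) ∧ 0 < a i z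
    · obtain ⟨z, hz, hzi⟩ := hi
      exact ⟨z, 0, hz, fun _ => le_rfl, fun u => by simp, by simpa using hzi⟩
    · push Not at hi
      obtain ⟨m, hm, hφ⟩ := farkas a (-(a i)) (fun z hz => by simpa using hi z hz)
      refine ⟨0, fun k => m k + if k = i then 1 else 0, fun k => by simp, fun k => ?_,
        fun u => ?_, ?_⟩
      · have := hm k
        dsimp only
        split_ifs <;> linarith
      · have := hφ u
        simp only [LinearMap.neg_apply] at this
        simp [add_mul, Finset.sum_add_distrib, ← this]
      · have := hm i
        simp only [if_true, map_zero]
        linarith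
  choose z l hz hl hsum hpos using key
  refine ⟨∑ j, z j, fun i => ?_, fun i => ∑ j, l j i, fun i => ?_, fun u => ?_, fun i => ?_⟩
  · rw [map_sum]
    exact Finset.sum_nonneg fun j _ => hz j i
  · exact Finset.sum_nonneg fun j _ => hl j i
  · simp_rw [Finset.sum_mul]
    rw [Finset.sum_comm]
    exact Finset.sum_eq_zero fun j _ => hsum j u
  · rw [map_sum, ← Finset.sum_add_distrib]
    exact Finset.sum_pos' (fun j _ => add_nonneg (hl j i) (hz j i)) ⟨i, Finset.mem_univ i, hpos i⟩

end Farkas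

/-! ### Relative interiors and faces of cones -/

section Cone

variable {X : Type*} [NormedAddCommGroup X] [InnerProductSpace ℝ X]

lemma cone_smul_mem (C : PointedCone ℝ X) {x : X} (hx : x ∈ C) {a : ℝ} (ha : 0 ≤ a) :
    a • x ∈ C :=
  C.smul_mem ha hx

lemma coe_affineSpan_cone (C : PointedCone ℝ X) :
    (affineSpan ℝ (C : Set X) : Set X) = Submodule.span ℝ (C : Set X) := by
  rw [← affineSpan_insert_zero, Set.insert_eq_of_mem C.zero_mem]

lemma mem_intrinsicInterior_cone_iff_ball (C : PointedCone ℝ X) {x : X} :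
    x ∈ intrinsicInterior ℝ (C : Set X) ↔
      x ∈ C ∧ ∃ δ > 0, ∀ v ∈ Submodule.span ℝ (C : Set X), dist v x < δ → v ∈ C := by
  have hspan : ∀ v, v ∈ affineSpan ℝ (C : Set X) ↔ v ∈ Submodule.span ℝ (C : Set X) := fun v => by
    rw [← SetLike.mem_coe, coe_affineSpan_cone, SetLike.mem_coe]
  rw [mem_intrinsicInterior]
  constructor
  · rintro ⟨y, hy, rfl⟩
    refine ⟨interior_subset (s := ((↑) ⁻¹' (C : Set X) : Set (affineSpan ℝ (C : Set X)))) hy, ?_⟩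
    rw [mem_interior_iff_mem_nhds, Metric.mem_nhds_iff] at hy
    obtain ⟨δ, hδ, h⟩ := hy
    exact ⟨δ, hδ, fun v hv hd => h (show (⟨v, (hspan v).2 hv⟩ : affineSpan ℝ (C : Set X)) ∈ _ from hd)⟩
  · rintro ⟨hx, δ, hδ, h⟩
    refine ⟨⟨x, (hspan x).2 (Submodule.subset_span hx)⟩, ?_, rfl⟩
    rw [mem_interior_iff_mem_nhds, Metric.mem_nhds_iff]
    exact ⟨δ, hδ, fun v hv => h v ((hspan _).1 v.2) hv⟩

/-- Algebraic description of the relative interior of a convex cone: from a point of it, one can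
move a little away from each point of the cone. -/
lemma mem_intrinsicInterior_cone_iff [FiniteDimensional ℝ X] (C : PointedCone ℝ X) {x : X} :
    x ∈ intrinsicInterior ℝ (C : Set X) ↔ x ∈ C ∧ ∀ y ∈ C, ∃ ε : ℝ, 0 < ε ∧ x - ε • y ∈ C := by
  constructor
  · intro h
    obtain ⟨hx, δ, hδ, h⟩ := (mem_intrinsicInterior_cone_iff_ball C).1 h
    refine ⟨hx, fun y hy => ?_⟩
    have hpos : 0 < ‖y‖ + 1 := by positivity
    refine ⟨δ / (‖y‖ + 1), by positivity, h _ (Submodule.sub_mem _ (Submodule.subset_span hx)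
      (Submodule.smul_mem _ _ (Submodule.subset_span hy))) ?_⟩
    rw [dist_eq_norm, sub_sub_cancel_left, norm_neg, norm_smul, Real.norm_of_nonneg (by positivity),
      div_mul_eq_mul_div, div_lt_iff₀ hpos]
    nlinarith [norm_nonneg y]
  · rintro ⟨hx, h⟩
    obtain ⟨y, hy⟩ := Set.Nonempty.intrinsicInterior C.convex ⟨0, C.zero_mem⟩
    obtain ⟨hyC, δ, hδ, hball⟩ := (mem_intrinsicInterior_cone_iff_ball C).1 hy
    obtain ⟨ε, hε, hz⟩ := h y hyC
    refine (mem_intrinsicInterior_cone_iff_ball C).2 ⟨hx, ε * δ, by positivity, fun v hv hd => ?_⟩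
    -- `v = (x - ε y) + ε u` with `u` close to the relative interior point `y`
    have hu : ε⁻¹ • (v - (x - ε • y)) ∈ C := by
      refine hball _ (Submodule.smul_mem _ _ (Submodule.sub_mem _ hv (Submodule.subset_span hz))) ?_
      have : ε⁻¹ • (v - (x - ε • y)) - y = ε⁻¹ • (v - x) := by
        rw [← sub_add, smul_add, smul_smul, inv_mul_cancel₀ hε.ne', one_smul, add_sub_cancel_right]
      rw [dist_eq_norm, this, norm_smul, norm_inv, Real.norm_of_nonneg hε.le, ← dist_eq_norm,
        inv_mul_lt_iff₀ hε]
      exact hd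
    have := C.add_mem hz (cone_smul_mem C hu hε.le)
    rwa [smul_smul, mul_inv_cancel₀ hε.ne', one_smul, add_sub_cancel] at this

lemma add_mem_intrinsicInterior_cone [FiniteDimensional ℝ X] (C : PointedCone ℝ X) {x y : X}
    (hx : x ∈ C) (hy : y ∈ intrinsicInterior ℝ (C : Set X)) :
    x + y ∈ intrinsicInterior ℝ (C : Set X) := by
  rw [mem_intrinsicInterior_cone_iff] at hy ⊢
  refine ⟨C.add_mem hx hy.1, fun z hz => ?_⟩
  obtain ⟨ε, hε, h⟩ := hy.2 z hz
  exact ⟨ε, hε, by rw [add_sub_assoc]; exact C.add_mem hx h⟩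

lemma smul_mem_intrinsicInterior_cone [FiniteDimensional ℝ X] (C : PointedCone ℝ X) {x : X}
    (hx : x ∈ intrinsicInterior ℝ (C : Set X)) {a : ℝ} (ha : 0 < a) :
    a • x ∈ intrinsicInterior ℝ (C : Set X) := by
  rw [mem_intrinsicInterior_cone_iff] at hx ⊢
  refine ⟨cone_smul_mem C hx.1 ha.le, fun z hz => ?_⟩
  obtain ⟨ε, hε, h⟩ := hx.2 z hz
  refine ⟨a * ε, by positivity, ?_⟩
  rw [mul_smul, ← smul_sub]
  exact cone_smul_mem C h ha.le

/-- From a relative interior point of a cone one can move a little in each direction of the span. -/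
lemma exists_add_smul_mem_of_mem_span (C : PointedCone ℝ X) {x v : X}
    (hx : x ∈ intrinsicInterior ℝ (C : Set X)) (hv : v ∈ Submodule.span ℝ (C : Set X)) :
    ∃ ε : ℝ, 0 < ε ∧ x + ε • v ∈ C := by
  obtain ⟨hx, δ, hδ, h⟩ := (mem_intrinsicInterior_cone_iff_ball C).1 hx
  have hpos : 0 < ‖v‖ + 1 := by positivity
  refine ⟨δ / (‖v‖ + 1), by positivity, h _ (Submodule.add_mem _ (Submodule.subset_span hx)
    (Submodule.smul_mem _ _ hv)) ?_⟩
  rw [dist_eq_norm, add_sub_cancel_left, norm_smul, Real.norm_of_nonneg (by positivity),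
    div_mul_eq_mul_div, div_lt_iff₀ hpos]
  nlinarith [norm_nonneg v]

lemma face_smul_mem (C : PointedCone ℝ X) {F : Set X} (hF : IsFace (C : Set X) F) {x : X}
    (hx : x ∈ F) {a : ℝ} (ha : 0 ≤ a) : a • x ∈ F := by
  have hxC : x ∈ C := hF.1.subset hx
  -- `x` is the midpoint of `0` and `2 x`, and lies between `a x` and `0` if `1 < a`
  have h0 : (0 : X) ∈ F := hF.1.left_mem_of_mem_openSegment C.zero_mem
    (cone_smul_mem C hxC (by norm_num : (0 : ℝ) ≤ 2)) hx
    ⟨1 / 2, 1 / 2, by norm_num, by norm_num, by norm_num, by simp⟩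
  rcases le_or_gt a 1 with h1 | h1
  · have := hF.2 hx h0 ha (sub_nonneg.2 h1) (by ring)
    simpa using this
  · refine hF.1.left_mem_of_mem_openSegment (cone_smul_mem C hxC ha) C.zero_mem hx
      ⟨a⁻¹, 1 - a⁻¹, by positivity, sub_pos.2 (inv_lt_one_of_one_lt₀ h1), by ring, ?_⟩
    rw [smul_zero, add_zero, smul_smul, inv_mul_cancel₀ (by positivity), one_smul]

/-- A nonempty face of a cone, as a cone. -/
def faceCone (C : PointedCone ℝ X) (F : Set X) (hF : IsFace (C : Set X) F) (hne : F.Nonempty) :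
    PointedCone ℝ X where
  carrier := F
  add_mem' := fun {x y} hx hy => by
    have := hF.2 (face_smul_mem C hF hx (zero_le_two (α := ℝ)))
      (face_smul_mem C hF hy (zero_le_two (α := ℝ)))
      (by norm_num : (0 : ℝ) ≤ 1 / 2) (by norm_num : (0 : ℝ) ≤ 1 / 2) (by norm_num)
    simpa [smul_smul] using this
  zero_mem' := by
    obtain ⟨x, hx⟩ := hne
    simpa using face_smul_mem C hF hx le_rfl
  smul_mem' := fun a _ hx => face_smul_mem C hF hx a.2

/-- A face that contains `s` contains each `y` that can be subtracted from `s` a little. -/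
lemma mem_face_of_sub_smul_mem (C : PointedCone ℝ X) {F : Set X} (hF : IsFace (C : Set X) F)
    {s y : X} (hs : s ∈ F) (hy : y ∈ C) {ε : ℝ} (hε : 0 < ε) (h : s - ε • y ∈ C) : y ∈ F := by
  have h2 : (2 * ε) • y ∈ F := by
    refine hF.1.left_mem_of_mem_openSegment (cone_smul_mem C hy (by positivity))
      (cone_smul_mem C h zero_le_two) hs ⟨1 / 2, 1 / 2, by norm_num, by norm_num, by norm_num, ?_⟩
    module
  have := face_smul_mem C hF h2 (a := (2 * ε)⁻¹) (by positivity)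
  rwa [smul_smul, inv_mul_cancel₀ (by positivity), one_smul] at this

lemma face_subset_of_span_le [FiniteDimensional ℝ X] (C : PointedCone ℝ X) {F G : Set X}
    (hF : IsFace (C : Set X) F) (hne : F.Nonempty) (hG : IsFace (C : Set X) G)
    (h : Submodule.span ℝ G ≤ Submodule.span ℝ F) : G ⊆ F := by
  intro y hy
  obtain ⟨s, hs⟩ := Set.Nonempty.intrinsicInterior (faceCone C F hF hne).convex hne
  obtain ⟨ε, hε, h'⟩ := exists_add_smul_mem_of_mem_span (faceCone C F hF hne) (v := -y) hs
    (Submodule.neg_mem _ (h (Submodule.subset_span hy)))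
  refine mem_face_of_sub_smul_mem C hF (intrinsicInterior_subset hs) (hG.1.subset hy) hε ?_
  rw [smul_neg, ← sub_eq_add_neg] at h'
  exact hF.1.subset h'

lemma minFace_eq_of_mem_intrinsicInterior [FiniteDimensional ℝ X] (C : PointedCone ℝ X)
    (G : PointedCone ℝ X) (hG : IsFace (C : Set X) G) {S : Set X} (hS : S ⊆ G) {s : X} (hs : s ∈ S)
    (hsG : s ∈ intrinsicInterior ℝ (G : Set X)) : minFace (C : Set X) S = G := by
  refine subset_antisymm (Set.sInter_subset_of_mem ⟨hG, hS⟩) (Set.subset_sInter ?_)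
  rintro F ⟨hF, hSF⟩ y hy
  obtain ⟨ε, hε, h⟩ := ((mem_intrinsicInterior_cone_iff G).1 hsG).2 y hy
  exact mem_face_of_sub_smul_mem C hF (hSF hs) (hG.1.subset hy) hε (hG.1.subset h)

lemma mem_perp_singleton {x d : X} : x ∈ perp {d} ↔ ⟪d, x⟫ = 0 := by simp [perp]

/-- A functional that is nonnegative on `C` exposes a face of `C`. -/
lemma isFace_inter_perp (C : PointedCone ℝ X) {d : X} (hd : d ∈ dualCone (C : Set X)) :
    IsFace (C : Set X) ((C : Set X) ∩ perp {d}) := by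
  refine ⟨⟨Set.inter_subset_left, ?_⟩, C.convex.inter ?_⟩
  · rintro x hx y hy z ⟨-, hz⟩ ⟨a, b, ha, hb, -, rfl⟩
    refine ⟨hx, ?_⟩
    rw [mem_perp_singleton] at hz ⊢
    rw [inner_add_right, inner_smul_right, inner_smul_right] at hz
    have h1 : 0 ≤ ⟪d, x⟫ := by rw [real_inner_comm]; exact hd hx
    have h2 : 0 ≤ ⟪d, y⟫ := by rw [real_inner_comm]; exact hd hy
    nlinarith [mul_nonneg hb.le h2, mul_nonneg ha.le h1]
  · intro x hx y hy a b _ _ _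
    rw [mem_perp_singleton] at hx hy ⊢
    rw [inner_add_right, inner_smul_right, inner_smul_right, hx, hy]
    simp

/-- The part of a closed convex cone in the hyperplane orthogonal to `d`, as a closed convex cone. -/
def hyperplaneSection (C : ProperCone ℝ X) (d : X) : ProperCone ℝ X where
  carrier := (C : Set X) ∩ perp {d}
  add_mem' := fun {u v} hu hv => ⟨C.toPointedCone.add_mem hu.1 hv.1, by
    have h1 := hu.2
    have h2 := hv.2
    rw [mem_perp_singleton] at *
    rw [inner_add_right, h1, h2, add_zero]⟩
  zero_mem' := ⟨C.toPointedCone.zero_mem, by simp [mem_perp_singleton]⟩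
  smul_mem' := fun r u hu => ⟨cone_smul_mem C.toPointedCone hu.1 r.2, by
    have h1 := hu.2
    have hr : r • u = (r : ℝ) • u := rfl
    rw [mem_perp_singleton] at *
    rw [hr, inner_smul_right, h1, mul_zero]⟩
  isClosed' := C.isClosed.inter (by
    have : perp {d} = {x : X | ⟪d, x⟫ = 0} := Set.ext fun x => mem_perp_singleton
    rw [this]
    exact isClosed_eq (by fun_prop) continuous_const)

lemma coe_hyperplaneSection (C : ProperCone ℝ X) (d : X) :
    (hyperplaneSection C d : Set X) = (C : Set X) ∩ perp {d} := rfl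

/-- A positive number below each of finitely many positive numbers. -/
lemma exists_pos_forall_le {ι : Type*} [Finite ι] (ε : ι → ℝ) (h : ∀ i, 0 < ε i) :
    ∃ δ : ℝ, 0 < δ ∧ ∀ i, δ ≤ ε i := by
  rcases isEmpty_or_nonempty ι with hι | hι
  · exact ⟨1, one_pos, fun i => hι.elim i⟩
  · obtain ⟨i, hi⟩ := Finite.exists_min ε
    exact ⟨ε i, h i, hi⟩

/-- Strict complementarity for a polyhedral cone: if `x` is a nonnegative combination of the normals
and the multipliers vanish exactly at the inequalities that are strict at `s`, then `s` is a relative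
interior point of the face exposed by `x`. -/
lemma mem_intrinsicInterior_of_strict [FiniteDimensional ℝ X] (F : ProperCone ℝ X) (T : Finset X)
    (hF : ∀ x, x ∈ F ↔ ∀ v ∈ T, 0 ≤ ⟪v, x⟫) (l : T → ℝ) (hl : ∀ v, 0 ≤ l v) {s : X} (hs : s ∈ F)
    (hx : ⟪∑ v, l v • v.1, s⟫ = 0) (hpos : ∀ v, 0 < l v + ⟪v.1, s⟫) :
    s ∈ intrinsicInterior ℝ ((F : Set X) ∩ perp {∑ v, l v • v.1}) := by
  rw [← coe_hyperplaneSection]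
  refine (mem_intrinsicInterior_cone_iff (hyperplaneSection F _).toPointedCone).2
    ⟨⟨hs, mem_perp_singleton.2 hx⟩, fun u hu => ?_⟩
  have huF : u ∈ F := hu.1
  have hxu : ∑ v : T, l v * ⟪v.1, u⟫ = 0 := by
    have h1 := mem_perp_singleton.1 hu.2
    simpa only [sum_inner, real_inner_smul_left] using h1
  have hzero : ∀ v : T, l v * ⟪v.1, u⟫ = 0 := fun v =>
    (Finset.sum_eq_zero_iff_of_nonneg fun v _ =>
      mul_nonneg (hl v) ((hF u).1 huF v.1 v.2)).1 hxu v (Finset.mem_univ v)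
  have hex : ∀ v : T, ∃ ε : ℝ, 0 < ε ∧ ∀ δ : ℝ, 0 ≤ δ → δ ≤ ε → 0 ≤ ⟪v.1, s - δ • u⟫ := by
    intro v
    have hsv := (hF s).1 hs v.1 v.2
    have huv := (hF u).1 huF v.1 v.2
    rcases (hl v).eq_or_lt' with h0 | h0
    · have h1 : 0 < ⟪v.1, s⟫ := by simpa [h0] using hpos v
      refine ⟨⟪v.1, s⟫ / (⟪v.1, u⟫ + 1), by positivity, fun δ hδ hle => ?_⟩
      rw [le_div_iff₀ (by positivity)] at hle
      rw [inner_sub_right, inner_smul_right]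
      linarith
    · have h1 := (mul_eq_zero.1 (hzero v)).resolve_left h0.ne'
      refine ⟨1, one_pos, fun δ _ _ => ?_⟩
      rw [inner_sub_right, inner_smul_right, h1]
      linarith
  choose ε hε hεle using hex
  obtain ⟨δ, hδ, hδle⟩ := exists_pos_forall_le ε hε
  refine ⟨δ, hδ, (hF _).2 fun v hv => hεle ⟨v, hv⟩ δ hδ.le (hδle _), ?_⟩
  have h2 := mem_perp_singleton.1 hu.2
  rw [mem_perp_singleton, inner_sub_right, inner_smul_right, hx, h2, mul_zero, sub_zero]

lemma isFace_refl (C : PointedCone ℝ X) : IsFace (C : Set X) C := ⟨IsExtreme.refl _ _, C.convex⟩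

lemma IsFace.trans {C F G : Set X} (hF : IsFace C F) (hG : IsFace F G) : IsFace C G :=
  ⟨hF.1.trans hG.1, hG.2⟩

end Cone

/-! ### Farkas' lemma under a partial polyhedral Slater condition -/

section Slater

open scoped Pointwise

variable {Z W V : Type*} [AddCommGroup Z] [Module ℝ Z] [NormedAddCommGroup W]
  [InnerProductSpace ℝ W] [FiniteDimensional ℝ W] [AddCommGroup V] [Module ℝ V]

/-- A function `n ↦ n s + b` that is nonnegative on `[0, ∞)` has a nonnegative slope. -/
lemma nonneg_of_forall_mul_add_nonneg {s b : ℝ} (h : ∀ n : ℝ, 0 ≤ n → 0 ≤ n * s + b) : 0 ≤ s := by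
  by_contra hs
  push Not at hs
  have h1 := h ((|b| + 1) / -s) (div_nonneg (by positivity) (by linarith))
  have h2 : (|b| + 1) / -s * s = -(|b| + 1) := by
    rw [div_neg, neg_mul, div_mul_cancel₀ _ hs.ne]
  linarith [le_abs_self b]

/-- Separation under Slater's condition: `φ` is nonnegative on `D ∩ B⁻¹ C` for convex cones `C`, `D`,
and some point of `D` is mapped to an interior point of `C`. -/
lemma exists_multiplier_of_interior (B : Z →ₗ[ℝ] W) (C : PointedCone ℝ W) (D : PointedCone ℝ Z)
    (φ : Z →ₗ[ℝ] ℝ) {z₀ : Z} (hz₀ : z₀ ∈ D) (hB : B z₀ ∈ interior (C : Set W))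
    (h : ∀ z ∈ D, B z ∈ C → 0 ≤ φ z) :
    ∃ x ∈ dualCone (C : Set W), ∀ z ∈ D, ⟪x, B z⟫ ≤ φ z := by
  set S : Set (W × ℝ) := (interior (C : Set W) ×ˢ Set.Ioi 0) +
    (((-B).prod φ) '' (D : Set Z)) with hS
  have hopen : IsOpen S := (isOpen_interior.prod isOpen_Ioi).add_right
  have hconv : Convex ℝ S := (C.convex.interior.prod (convex_Ioi 0)).add (D.convex.linear_image _)
  have hmem : ∀ u ∈ interior (C : Set W), ∀ z ∈ D, ∀ ρ : ℝ, 0 < ρ → (u - B z, ρ + φ z) ∈ S :=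
    fun u hu z hz ρ hρ => by
      refine Set.mem_add.2 ⟨(u, ρ), ⟨hu, hρ⟩, (-B z, φ z), ⟨z, hz, rfl⟩, ?_⟩
      simp [sub_eq_add_neg]
  have h0 : (0 : W × ℝ) ∉ S := by
    rintro ⟨⟨u, ρ⟩, ⟨hu, hρ⟩, _, ⟨z, hz, rfl⟩, hsum⟩
    have h1 : u = B z := sub_eq_zero.1 ((sub_eq_add_neg u (B z)).trans (congrArg Prod.fst hsum))
    have h2 : ρ + φ z = 0 := congrArg Prod.snd hsum
    have h3 := h z hz (h1 ▸ interior_subset hu)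
    have hρ' : 0 < ρ := hρ
    linarith
  obtain ⟨f, hf⟩ := geometric_hahn_banach_open_point hconv hopen h0
  have hsplit : ∀ w r, f (w, r) = f (w, 0) + r * f (0, 1) := fun w r => by
    rw [← smul_eq_mul, ← map_smul, ← map_add]
    simp
  have hneg : f (0, 1) < 0 := by
    have h1 := hf _ (hmem _ hB _ hz₀ 1 one_pos)
    rw [sub_self, hsplit, map_zero] at h1
    have h2 := h _ hz₀ (interior_subset hB)
    have h3 : f ((0 : W), (0 : ℝ)) = 0 := by rw [← Prod.zero_eq_mk, map_zero]
    by_contra hc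
    push Not at hc
    nlinarith
  -- the separating functional, normalized in the last coordinate
  let g : StrongDual ℝ W := (f (0, 1))⁻¹ • f.comp (ContinuousLinearMap.inl ℝ W ℝ)
  have hg : ∀ w, f (w, 0) = f (0, 1) * g w := fun w => by
    simp only [g, smul_apply, ContinuousLinearMap.comp_apply,
      ContinuousLinearMap.inl_apply, smul_eq_mul]
    rw [mul_inv_cancel_left₀ hneg.ne]
  have key : ∀ u ∈ interior (C : Set W), ∀ z ∈ D, 0 ≤ g u - g (B z) + φ z := fun u hu z hz => by
    refine le_of_forall_pos_lt_add fun ρ hρ => ?_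
    have h1 := hf _ (hmem u hu z hz ρ hρ)
    rw [hsplit, hg, map_sub, map_zero, mul_comm _ (f (0, 1)), ← mul_add] at h1
    have := pos_of_mul_neg_right h1 hneg.le
    linarith
  have hx : ∀ w, ⟪(InnerProductSpace.toDual ℝ W).symm g, w⟫ = g w := fun w => by simp
  refine ⟨(InnerProductSpace.toDual ℝ W).symm g, fun u hu => ?_, fun z hz => ?_⟩
  · rw [innerₗ_apply_apply, real_inner_comm, hx]
    refine nonneg_of_forall_mul_add_nonneg (b := g (B z₀)) fun n hn => ?_
    have hsub : {n • u} + interior (C : Set W) ⊆ interior (C : Set W) := by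
      refine interior_maximal ?_ isOpen_interior.add_left
      rintro _ ⟨_, rfl, v, hv, rfl⟩
      exact C.add_mem (cone_smul_mem C hu hn) (interior_subset hv)
    simpa using key _ (hsub (Set.add_mem_add rfl hB)) 0 D.zero_mem
  · rw [hx, ← sub_nonneg]
    refine nonneg_of_forall_mul_add_nonneg (b := g (B z₀)) fun n hn => ?_
    have h1 := key _ hB _ (D.smul_mem hn hz)
    simp only [map_smul, smul_eq_mul] at h1
    linarith

/-- Farkas' lemma for a system of linear inequalities, linear equations and one conic constraint, under
the condition that some solution maps into the relative interior of the cone; the inequalities need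
not be strict at it. Slater's condition is applied within the span of the cone, and membership in the
span is added to the linear equations. -/
theorem farkas_of_mem_intrinsicInterior {ι : Type*} [Fintype ι] (B : Z →ₗ[ℝ] W) (M : Z →ₗ[ℝ] V)
    (a : ι → Z →ₗ[ℝ] ℝ) (C : PointedCone ℝ W) (φ : Z →ₗ[ℝ] ℝ) (z₀ : Z)
    (hB : B z₀ ∈ intrinsicInterior ℝ (C : Set W)) (hM : M z₀ = 0) (ha : ∀ i, 0 ≤ a i z₀)
    (h : ∀ z, B z ∈ C → M z = 0 → (∀ i, 0 ≤ a i z) → 0 ≤ φ z) :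
    ∃ x ∈ dualCone (C : Set W), ∃ l : ι → ℝ, (∀ i, 0 ≤ l i) ∧ ∃ ψ : V →ₗ[ℝ] ℝ,
      ∀ z, φ z = ⟪x, B z⟫ + ∑ i, l i * a i z + ψ (M z) := by
  set U := Submodule.span ℝ (C : Set W) with hU
  let P : W →ₗ[ℝ] W := U.starProjection
  have hP : ∀ w ∈ U, P w = w := fun w hw => Submodule.starProjection_eq_self_iff.2 hw
  have hPU : ∀ w, P w ∈ U := fun w => Submodule.starProjection_apply_mem U w
  let C' : PointedCone ℝ W := C.comap P
  have hC' : ∀ w, w ∈ C' ↔ P w ∈ C := fun w => Iff.rfl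
  obtain ⟨hBC, δ, hδ, hball⟩ := (mem_intrinsicInterior_cone_iff_ball C).1 hB
  have hint : B z₀ ∈ interior (C' : Set W) := by
    rw [mem_interior_iff_mem_nhds, Metric.mem_nhds_iff]
    refine ⟨δ, hδ, fun w hw => hball _ (hPU w) ?_⟩
    change dist (P w) (B z₀) < δ
    rw [← hP _ (Submodule.subset_span hBC), dist_eq_norm, ← map_sub]
    refine lt_of_le_of_lt (Submodule.norm_starProjection_apply_le U _) ?_
    rwa [← dist_eq_norm]
  let M' : Z →ₗ[ℝ] V × W := M.prod (B - P.comp B)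
  have hM' : ∀ z, M' z = 0 ↔ M z = 0 ∧ B z = P (B z) := fun z => by
    simp [M', Prod.ext_iff, sub_eq_zero]
  let D : PointedCone ℝ Z :=
    { carrier := {z | M' z = 0 ∧ ∀ i, 0 ≤ a i z}
      add_mem' := fun {y z} hy hz => ⟨by rw [map_add, hy.1, hz.1, add_zero],
        fun i => by rw [map_add]; exact add_nonneg (hy.2 i) (hz.2 i)⟩
      zero_mem' := ⟨map_zero _, fun i => by simp⟩
      smul_mem' := fun r z hz => by
        have hr : r • z = (r : ℝ) • z := rfl
        refine ⟨by rw [hr, map_smul, hz.1, smul_zero], fun i => ?_⟩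
        rw [hr, map_smul]
        exact mul_nonneg r.2 (hz.2 i) }
  obtain ⟨x, hx, hxφ⟩ := exists_multiplier_of_interior B C' D φ (z₀ := z₀)
    ⟨(hM' _).2 ⟨hM, (hP _ (Submodule.subset_span hBC)).symm⟩, ha⟩ hint
    (fun z hz hzC => h z (by rw [((hM' z).1 hz.1).2]; exact hzC) ((hM' z).1 hz.1).1 hz.2)
  obtain ⟨l, hl, ψ, hφ⟩ := farkas_of_eq a M' (φ - (innerₗ W x).comp B)
    (fun z hz hza => by simpa using hxφ z ⟨hz, hza⟩)
  -- the multiplier of the constraint `B z ∈ U` is a vector orthogonal to `U`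
  let p : W →ₗ[ℝ] ℝ := (ψ.comp (LinearMap.inr ℝ V W)).comp (LinearMap.id - P)
  let n : W := (InnerProductSpace.toDual ℝ W).symm (LinearMap.toContinuousLinearMap p)
  have hn : ∀ w, ⟪n, w⟫ = ψ (0, w - P w) := fun w => by simp [n, p]
  refine ⟨x + n, fun w hw => ?_, l, hl, ψ.comp (LinearMap.inl ℝ V W), fun z => ?_⟩
  · have h1 : 0 ≤ ⟪w, x⟫ := hx ((hC' w).2 (by rwa [hP _ (Submodule.subset_span hw)]))
    rw [innerₗ_apply_apply, inner_add_right, real_inner_comm n w, hn,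
      hP _ (Submodule.subset_span hw), sub_self, ← Prod.zero_eq_mk, map_zero, add_zero]
    exact h1
  · have h1 := hφ z
    have h2 : M' z = (M z, 0) + (0, B z - P (B z)) := by simp [M']
    rw [h2, map_add, ← hn] at h1
    simp only [LinearMap.sub_apply, LinearMap.comp_apply, innerₗ_apply_apply] at h1
    rw [inner_add_left]
    simp only [LinearMap.comp_apply, LinearMap.inl_apply]
    linarith

/-- `e` satisfies the partial polyhedral Slater condition for `F`: the set `F` is the intersection of a
polyhedral cone and a convex cone, and `e` is a point of the former that lies in the relative interior
of the latter. -/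
def IsSlaterPoint (F : Set W) (e : W) : Prop :=
  ∃ (T : Finset W) (C : PointedCone ℝ W), F = {x | (∀ a ∈ T, 0 ≤ ⟪a, x⟫) ∧ x ∈ C} ∧
    (∀ a ∈ T, 0 ≤ ⟪a, e⟫) ∧ e ∈ intrinsicInterior ℝ (C : Set W)

omit [FiniteDimensional ℝ W] in
lemma IsSlaterPoint.mem {F : Set W} {e : W} (h : IsSlaterPoint F e) : e ∈ F := by
  obtain ⟨T, C, rfl, hT, hC⟩ := h
  exact ⟨hT, intrinsicInterior_subset hC⟩

omit [FiniteDimensional ℝ W] in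
lemma IsPolyhedral.isSlaterPoint {F : Set W} (h : IsPolyhedral F) {e : W} (he : e ∈ F) :
    IsSlaterPoint F e := by
  obtain ⟨T, rfl⟩ := h
  exact ⟨T, ⊤, by simp, he, interior_subset_intrinsicInterior (by simp)⟩

theorem farkas_of_isSlaterPoint {ι : Type*} [Fintype ι] (B : Z →ₗ[ℝ] W) (a : ι → Z →ₗ[ℝ] ℝ)
    (F : Set W) (φ : Z →ₗ[ℝ] ℝ) (z₀ : Z) (hB : IsSlaterPoint F (B z₀)) (ha : ∀ i, 0 ≤ a i z₀)
    (h : ∀ z, B z ∈ F → (∀ i, 0 ≤ a i z) → 0 ≤ φ z) :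
    ∃ x ∈ dualCone F, ∃ l : ι → ℝ, (∀ i, 0 ≤ l i) ∧ ∀ z, φ z = ⟪x, B z⟫ + ∑ i, l i * a i z := by
  obtain ⟨T, C, rfl, hT, hC⟩ := hB
  obtain ⟨x, hx, l, hl, ψ, hφ⟩ := farkas_of_mem_intrinsicInterior B (0 : Z →ₗ[ℝ] ℝ)
    (Sum.elim a fun v : T => (innerₗ W v.1).comp B) C φ z₀ hC rfl
    (by rintro (i | ⟨v, hv⟩); exacts [ha i, hT v hv])
    (fun z hz _ hza => h z ⟨fun v hv => hza (Sum.inr ⟨v, hv⟩), hz⟩ fun i => hza (Sum.inl i))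
  refine ⟨x + ∑ v : T, l (Sum.inr v) • v.1, fun w hw => ?_, fun i => l (Sum.inl i),
    fun i => hl _, fun z => ?_⟩
  · rw [innerₗ_apply_apply, inner_add_right, inner_sum]
    refine add_nonneg (hx hw.2) (Finset.sum_nonneg fun v _ => ?_)
    rw [inner_smul_right, real_inner_comm]
    exact mul_nonneg (hl _) (hw.1 v.1 v.2)
  · rw [hφ z, inner_add_left, sum_inner, Fintype.sum_sum_type]
    simp only [Sum.elim_inl, Sum.elim_inr, LinearMap.comp_apply, innerₗ_apply_apply,
      LinearMap.zero_apply, map_zero, add_zero, real_inner_smul_left]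
    ring

end Slater

/-! ### Strong duality -/

section Duality

variable {X Y : Type*} [NormedAddCommGroup X] [InnerProductSpace ℝ X] [FiniteDimensional ℝ X]
  [NormedAddCommGroup Y] [InnerProductSpace ℝ Y] [FiniteDimensional ℝ Y]

lemma inner_adj (A : X →ₗ[ℝ] Y) (x : X) (y : Y) : ⟪x, adj A y⟫ = ⟪A x, y⟫ :=
  LinearMap.adjoint_inner_right A x y

lemma inner_sub_adj (A : X →ₗ[ℝ] Y) (c x : X) (y : Y) :
    ⟪x, c - adj A y⟫ = ⟪c, x⟫ - ⟪A x, y⟫ := by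
  rw [inner_sub_right, inner_adj, real_inner_comm]

/-- The dual cone, as a cone. -/
def dualPC (U : Set X) : PointedCone ℝ X := PointedCone.dual (innerₗ X) U

lemma mem_of_mem_dualCone_dualCone (K : ProperCone ℝ X) {s : X}
    (hs : s ∈ dualCone (dualCone (K : Set X))) : s ∈ K := by
  rw [← ProperCone.innerDual_innerDual K]
  exact hs

omit [FiniteDimensional ℝ X] in
lemma dualCone_anti {U V : Set X} (h : U ⊆ V) : dualCone V ⊆ dualCone U :=
  fun _ hx _ hs => hx (h hs)

lemma dualValue_le_primalValue (A : X →ₗ[ℝ] Y) (b : Y) (c : X) (F : Set X) :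
    dualValue A b c F ≤ primalValue A b c F := by
  refine iSup₂_le fun y hy => le_iInf₂ fun x hx => ?_
  have := hx.2 hy
  rw [innerₗ_apply_apply, real_inner_comm, inner_sub_adj, hx.1] at this
  exact EReal.coe_le_coe_iff.2 (by linarith)

/-- A Slater slack makes the primal problem attain the value of the dual one. -/
theorem exists_primal_of_dual_le (A : X →ₗ[ℝ] Y) (b : Y) (c : X) (F : PointedCone ℝ X) {y₀ : Y}
    (h₀ : IsSlaterPoint (F : Set X) (c - adj A y₀)) {v : ℝ}
    (h : ∀ y, c - adj A y ∈ F → ⟪b, y⟫ ≤ v) :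
    ∃ x ∈ primalFeasible A b (F : Set X), ⟪c, x⟫ ≤ v := by
  -- homogenization: the additional variable `τ` multiplies `c`
  let B : Y × ℝ →ₗ[ℝ] X := (LinearMap.snd ℝ Y ℝ).smulRight c - (adj A).comp (LinearMap.fst ℝ Y ℝ)
  let φ : Y × ℝ →ₗ[ℝ] ℝ := v • LinearMap.snd ℝ Y ℝ - (innerₗ Y b).comp (LinearMap.fst ℝ Y ℝ)
  have hB : ∀ y τ, B (y, τ) = τ • c - adj A y := fun y τ => by simp [B]
  have hφ : ∀ y τ, φ (y, τ) = v * τ - ⟪b, y⟫ := fun y τ => by simp [φ]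
  obtain ⟨x, hx, l, hl, hid⟩ := farkas_of_isSlaterPoint B
    (fun _ : Unit => LinearMap.snd ℝ Y ℝ) (F : Set X) φ (y₀, 1)
    (by rw [hB, one_smul]; exact h₀) (fun _ => by simp) (fun z hz hτ => by
      obtain ⟨y, τ⟩ := z
      have hτ : 0 ≤ τ := hτ ()
      -- moving towards `(y₀, 1)` makes `τ` positive
      refine nonneg_of_forall_mul_add_nonneg (b := φ (y₀, 1)) fun n hn => ?_
      have hpos : 0 < n * τ + 1 := by positivity
      have hmem : c - adj A ((n * τ + 1)⁻¹ • (n • y + y₀)) ∈ F := by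
        have h1 := cone_smul_mem F (F.add_mem (cone_smul_mem F hz hn) h₀.mem)
          (inv_nonneg.2 hpos.le)
        convert h1 using 1
        rw [hB]
        simp only [map_smul, map_add]
        have h2 : c = (n * τ + 1)⁻¹ • (n * τ + 1) • c := by
          rw [smul_smul, inv_mul_cancel₀ hpos.ne', one_smul]
        nth_rewrite 1 [h2]
        module
      have h3 := h _ hmem
      rw [inner_smul_right, inner_add_right, inner_smul_right, inv_mul_le_iff₀ hpos] at h3
      rw [hφ, hφ]
      linarith)
  refine ⟨x, ⟨?_, hx⟩, ?_⟩
  · refine ext_inner_right ℝ fun y => ?_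
    have h1 := hid (y, 0)
    rw [hφ, hB, zero_smul, zero_sub, inner_neg_right, inner_adj] at h1
    simp at h1
    linarith
  · have h1 := hid (0, 1)
    rw [hφ, hB, map_zero, one_smul, sub_zero, real_inner_comm] at h1
    simp at h1
    have h2 := hl ()
    rw [h1, real_inner_comm]
    linarith

theorem strongDualityRestored_of_isSlaterPoint (A : X →ₗ[ℝ] Y) (b : Y) (c : X) {K : Set X}
    (F : PointedCone ℝ X) {y₀ : Y} (h₀ : IsSlaterPoint (F : Set X) (c - adj A y₀))
    (hKF : ∀ y, c - adj A y ∈ K ↔ c - adj A y ∈ F) :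
    StrongDualityRestored A b c K (F : Set X) := by
  have hval : dualValue A b c K = dualValue A b c (F : Set X) := by
    unfold dualValue
    simp only [Set.mem_ofPred_eq, hKF, SetLike.mem_coe]
  rw [StrongDualityRestored, hval]
  have hge := dualValue_le_primalValue A b c (F : Set X)
  have hbot : dualValue A b c (F : Set X) ≠ ⊥ := fun h => by
    have h1 : ((⟪b, y₀⟫ : ℝ) : EReal) ≤ dualValue A b c (F : Set X) :=
      le_iSup₂ (f := fun y (_ : y ∈ {y : Y | c - adj A y ∈ (F : Set X)}) => ((⟪b, y⟫ : ℝ) : EReal))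
        y₀ h₀.mem
    rw [h] at h1
    exact EReal.coe_ne_bot _ (le_bot_iff.1 h1)
  by_cases htop : dualValue A b c (F : Set X) = ⊤
  · refine ⟨le_antisymm (by rw [htop]; exact le_top) hge, fun _ h => absurd htop h⟩
  · obtain ⟨x, hx, hle⟩ := exists_primal_of_dual_le A b c F h₀
      (v := (dualValue A b c (F : Set X)).toReal) (fun y hy => by
        rw [← EReal.coe_le_coe_iff, EReal.coe_toReal htop hbot]
        exact le_iSup₂
          (f := fun y (_ : y ∈ {y : Y | c - adj A y ∈ (F : Set X)}) => ((⟪b, y⟫ : ℝ) : EReal)) y hy)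
    rw [← EReal.coe_le_coe_iff, EReal.coe_toReal htop hbot] at hle
    have hle' : primalValue A b c (F : Set X) ≤ ((⟪c, x⟫ : ℝ) : EReal) := iInf₂_le x hx
    exact ⟨le_antisymm (hle'.trans hle) hge, fun _ _ => ⟨x, hx, le_antisymm (hle.trans hge) hle'⟩⟩

/-- If the dual problem is infeasible and the primal one has a feasible point and an improving
direction, then both values are `-∞`. -/
theorem strongDualityRestored_of_infeasible (A : X →ₗ[ℝ] Y) (b : Y) (c : X) {K : Set X}
    (F : PointedCone ℝ X) {d : X} (hd : d ∈ dualCone (F : Set X)) (hA : A d = 0) (hc : ⟪c, d⟫ < 0)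
    (hK : slacks A c K = ∅) (hb : (primalFeasible A b (F : Set X)).Nonempty) :
    StrongDualityRestored A b c K (F : Set X) := by
  have hval : dualValue A b c K = ⊥ := by
    refine le_bot_iff.1 (iSup₂_le fun y hy => ?_)
    exact absurd (show c - adj A y ∈ slacks A c K from ⟨hy, y, rfl⟩) (hK ▸ Set.notMem_empty _)
  obtain ⟨x, hx⟩ := hb
  refine ⟨?_, fun h => absurd hval h⟩
  rw [hval, EReal.eq_bot_iff_forall_lt]
  intro v
  set n : ℝ := (|⟪c, x⟫ - v| + 1) / -⟪c, d⟫ with hn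
  have hpos : 0 < -⟪c, d⟫ := by linarith
  have hn0 : 0 ≤ n := by positivity
  have h1 : n * ⟪c, d⟫ = -(|⟪c, x⟫ - v| + 1) := by
    rw [hn, div_neg, neg_mul, div_mul_cancel₀ _ hc.ne]
  have hmem : x + n • d ∈ primalFeasible A b (F : Set X) :=
    ⟨by rw [map_add, map_smul, hA, smul_zero, add_zero, hx.1],
      (dualPC (F : Set X)).add_mem hx.2 (cone_smul_mem (dualPC (F : Set X)) hd hn0)⟩
  refine lt_of_le_of_lt (iInf₂_le _ hmem) (EReal.coe_lt_coe_iff.2 ?_)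
  rw [inner_add_right, inner_smul_right, h1]
  linarith [le_abs_self (⟪c, x⟫ - v)]

/-! ### The auxiliary pair of problems -/

/-- Weak duality for the auxiliary pair, with the gap written as a sum of three products. -/
lemma aux_gap {A : X →ₗ[ℝ] Y} {c e es x : X} {F : Set X} {t w : ℝ}
    (hp : AuxPrimalFeasible A c F e es x t w) (y₁ y₂ : ℝ) (y₃ : Y) :
    ⟪x, y₁ • c - y₂ • e - adj A y₃⟫ + t * (1 - y₁ * (1 + ⟪c, es⟫) + ⟪es, adj A y₃⟫)
      + w * (y₁ - y₂) = t - y₂ := by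
  obtain ⟨h1, h2, h3, -⟩ := hp
  have h4 : ⟪A x, y₃⟫ = t * ⟪A es, y₃⟫ := by
    rw [sub_eq_zero.1 h3, real_inner_smul_left]
  rw [inner_sub_right, inner_smul_right] at h1
  rw [inner_sub_right, inner_sub_right, inner_smul_right, inner_smul_right, inner_adj, inner_adj, h4,
    real_inner_comm c x, real_inner_comm e x]
  linear_combination -y₁ * h1 - y₂ * h2

lemma aux_weak_duality {A : X →ₗ[ℝ] Y} {c e es x : X} {F : Set X} {t w y₁ y₂ : ℝ} {y₃ : Y}
    (hp : AuxPrimalFeasible A c F e es x t w) (hd : AuxDualFeasible A c F e es y₁ y₂ y₃) :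
    y₂ ≤ t := by
  have h := aux_gap hp y₁ y₂ y₃
  have h1 := hp.2.2.2.1 hd.1
  rw [innerₗ_apply_apply, real_inner_comm] at h1
  have h2 := mul_nonneg hp.2.2.2.2.1 hd.2.1
  have h3 := mul_nonneg hp.2.2.2.2.2 hd.2.2
  linarith

/-- The slack map `(y₁, y₂, y₃, τ) ↦ c y₁ - e y₂ - Aᵀ y₃` of the homogenized auxiliary dual. -/
def auxB (A : X →ₗ[ℝ] Y) (c e : X) : ℝ × ℝ × Y × ℝ →ₗ[ℝ] X where
  toFun z := z.1 • c - z.2.1 • e - adj A z.2.2.1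
  map_add' z z' := by simp only [Prod.fst_add, Prod.snd_add, map_add]; module
  map_smul' r z := by
    simp only [Prod.smul_fst, Prod.smul_snd, map_smul, RingHom.id_apply, smul_eq_mul]; module

/-- The sign constraints `τ ≥ 0`, `σ ≥ 0` and `y₁ - y₂ ≥ 0` of the homogenized auxiliary dual. -/
def auxRow (A : X →ₗ[ℝ] Y) (c es : X) : Fin 3 → ℝ × ℝ × Y × ℝ →ₗ[ℝ] ℝ :=
  ![{ toFun := fun z => z.2.2.2
      map_add' := fun z z' => by simp
      map_smul' := fun r z => by simp },
    { toFun := fun z => z.2.2.2 - z.1 * (1 + ⟪c, es⟫) + ⟪es, adj A z.2.2.1⟫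
      map_add' := fun z z' => by
        simp only [Prod.fst_add, Prod.snd_add, map_add, inner_add_right]; ring
      map_smul' := fun r z => by
        simp only [Prod.smul_fst, Prod.smul_snd, map_smul, RingHom.id_apply, smul_eq_mul,
          inner_smul_right]
        ring },
    { toFun := fun z => z.1 - z.2.1
      map_add' := fun z z' => by simp only [Prod.fst_add, Prod.snd_add]; ring
      map_smul' := fun r z => by
        simp only [Prod.smul_fst, Prod.smul_snd, RingHom.id_apply, smul_eq_mul]
        ring }]

/-- The objective `t τ - y₂` of the homogenized auxiliary dual. -/
def auxObj (Y : Type*) [NormedAddCommGroup Y] [InnerProductSpace ℝ Y] (t : ℝ) :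
    ℝ × ℝ × Y × ℝ →ₗ[ℝ] ℝ where
  toFun z := t * z.2.2.2 - z.2.1
  map_add' z z' := by simp only [Prod.fst_add, Prod.snd_add]; ring
  map_smul' r z := by
    simp only [Prod.smul_fst, Prod.smul_snd, RingHom.id_apply, smul_eq_mul]; ring

/-- The objective of the homogenized auxiliary dual is nonnegative if `t` bounds the auxiliary dual
value: moving towards the feasible point `(0, -1, 0)` makes the homogenizing variable positive. -/
lemma auxObj_nonneg {A : X →ₗ[ℝ] Y} {c e es : X} {F : PointedCone ℝ X} (he : e ∈ F) {t : ℝ}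
    (h : ∀ y₁ y₂ y₃, AuxDualFeasible A c (F : Set X) e es y₁ y₂ y₃ → y₂ ≤ t)
    (z : ℝ × ℝ × Y × ℝ) (hz : auxB A c e z ∈ F) (hrow : ∀ i, 0 ≤ auxRow A c es i z) :
    0 ≤ auxObj Y t z := by
  obtain ⟨y₁, y₂, y₃, τ⟩ := z
  have h0 : 0 ≤ τ := hrow 0
  have h1 : 0 ≤ τ - y₁ * (1 + ⟪c, es⟫) + ⟪es, adj A y₃⟫ := hrow 1
  have h2 : 0 ≤ y₁ - y₂ := hrow 2
  have hz : y₁ • c - y₂ • e - adj A y₃ ∈ F := hz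
  change 0 ≤ t * τ - y₂
  refine nonneg_of_forall_mul_add_nonneg (b := t + 1) fun n hn => ?_
  have hpos : 0 < n * τ + 1 := by positivity
  have hinv : 0 ≤ (n * τ + 1)⁻¹ := inv_nonneg.2 hpos.le
  have h3 := h ((n * τ + 1)⁻¹ * (n * y₁)) ((n * τ + 1)⁻¹ * (n * y₂ - 1))
    ((n * τ + 1)⁻¹ • n • y₃) ⟨?_, ?_, ?_⟩
  · rw [inv_mul_le_iff₀ hpos] at h3
    linarith
  · have h4 := cone_smul_mem F (F.add_mem (cone_smul_mem F hz hn) he) hinv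
    change _ ∈ F
    convert h4 using 1
    simp only [map_smul]
    module
  · have h4 : 1 - (n * τ + 1)⁻¹ * (n * y₁) * (1 + ⟪c, es⟫)
        + ⟪es, adj A ((n * τ + 1)⁻¹ • n • y₃)⟫
        = (n * τ + 1)⁻¹ * (n * (τ - y₁ * (1 + ⟪c, es⟫) + ⟪es, adj A y₃⟫) + 1) := by
      simp only [map_smul, inner_smul_right]
      linear_combination (-1 : ℝ) * inv_mul_cancel₀ hpos.ne'
    rw [h4]
    positivity
  · rw [← mul_sub]
    refine mul_nonneg hinv ?_
    linarith [mul_nonneg hn h2]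

/-- Coordinates of a dependency between the constraints of the homogenized auxiliary dual. -/
lemma auxPrimalFeasible_of_identity {A : X →ₗ[ℝ] Y} {c e es x : X} {F : Set X} {t : ℝ}
    {l : Fin 3 → ℝ} (hx : x ∈ dualCone F) (hl : ∀ i, 0 ≤ l i)
    (h : ∀ z, auxObj Y t z = ⟪x, auxB A c e z⟫ + ∑ i, l i * auxRow A c es i z) :
    AuxPrimalFeasible A c F e es x (l 1) (l 2) ∧ t = l 0 + l 1 := by
  have h' : ∀ y₁ y₂ y₃ τ, t * τ - y₂ = ⟪x, y₁ • c - y₂ • e - adj A y₃⟫ + (l 0 * τ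
      + l 1 * (τ - y₁ * (1 + ⟪c, es⟫) + ⟪es, adj A y₃⟫) + l 2 * (y₁ - y₂)) :=
    fun y₁ y₂ y₃ τ => by
      have := h (y₁, y₂, y₃, τ)
      rw [Fin.sum_univ_three] at this
      exact this
  refine ⟨⟨?_, ?_, ?_, hx, hl 1, hl 2⟩, ?_⟩
  · have := h' 1 0 0 0
    simp only [map_zero, one_smul, zero_smul, sub_zero, inner_zero_right] at this
    rw [inner_sub_right, inner_smul_right, real_inner_comm]
    linarith
  · have := h' 0 1 0 0
    simp only [map_zero, one_smul, zero_smul, sub_zero, inner_zero_right, zero_sub,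
      inner_neg_right] at this
    rw [real_inner_comm]
    linarith
  · refine ext_inner_right ℝ fun y => ?_
    have := h' 0 0 y 0
    simp only [zero_smul, sub_zero, zero_sub, inner_neg_right, inner_adj] at this
    rw [inner_zero_left, inner_sub_left, real_inner_smul_left]
    linarith
  · have := h' 0 0 0 1
    simp only [zero_smul, sub_zero, map_zero, inner_zero_right] at this
    linarith

theorem exists_auxPrimal_of_dual_le {A : X →ₗ[ℝ] Y} {c e es : X} {F : PointedCone ℝ X}
    (he : IsSlaterPoint (F : Set X) e) {t : ℝ}
    (h : ∀ y₁ y₂ y₃, AuxDualFeasible A c (F : Set X) e es y₁ y₂ y₃ → y₂ ≤ t) :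
    ∃ x t' w, AuxPrimalFeasible A c (F : Set X) e es x t' w ∧ t' ≤ t := by
  obtain ⟨x, hx, l, hl, hid⟩ := farkas_of_isSlaterPoint (auxB A c e) (auxRow A c es) (F : Set X)
    (auxObj Y t) (0, -1, 0, 1) (by simpa [auxB] using he)
    (by simp [Fin.forall_fin_succ, auxRow]) (auxObj_nonneg he.mem h)
  obtain ⟨h1, h2⟩ := auxPrimalFeasible_of_identity hx hl hid
  exact ⟨x, l 1, l 2, h1, by linarith [hl 0]⟩

omit [FiniteDimensional ℝ X] [FiniteDimensional ℝ Y] in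
/-- The point `(e*, 1, 1)`, normalized, is feasible for the auxiliary primal. -/
lemma exists_auxPrimalFeasible (A : X →ₗ[ℝ] Y) (c : X) {F : Set X} {e es : X} (he : e ∈ F)
    (hes : es ∈ dualCone F) : ∃ x t w, AuxPrimalFeasible A c F e es x t w := by
  have hpos : 0 < ⟪e, es⟫ + 1 := by
    have : 0 ≤ ⟪e, es⟫ := hes he
    linarith
  refine ⟨(⟪e, es⟫ + 1)⁻¹ • es, (⟪e, es⟫ + 1)⁻¹, (⟪e, es⟫ + 1)⁻¹, by simp, ?_, by simp,
    cone_smul_mem (dualPC F) hes (inv_nonneg.2 hpos.le), by positivity, by positivity⟩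
  rw [inner_smul_right, ← mul_add_one, inv_mul_cancel₀ hpos.ne']

theorem exists_auxDual_of_le_primal {A : X →ₗ[ℝ] Y} {c e es : X} (F : ProperCone ℝ X) (he : e ∈ F)
    (hes : es ∈ intrinsicInterior ℝ (dualCone (F : Set X))) {t : ℝ}
    (h : ∀ x t' w, AuxPrimalFeasible A c (F : Set X) e es x t' w → t ≤ t') :
    ∃ y₁ y₂ y₃, AuxDualFeasible A c (F : Set X) e es y₁ y₂ y₃ ∧ t ≤ y₂ := by
  let M : X × ℝ × ℝ →ₗ[ℝ] Y × ℝ :=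
    { toFun := fun z => (A z.1 - z.2.1 • A es, -⟪c, z.1 - z.2.1 • es⟫ + z.2.1 - z.2.2)
      map_add' := fun z z' => by
        simp only [Prod.fst_add, Prod.snd_add, map_add, Prod.mk_add_mk, inner_sub_right,
          inner_add_right, inner_smul_right]
        ext
        · dsimp only; module
        · dsimp only; ring
      map_smul' := fun r z => by
        simp only [Prod.smul_fst, Prod.smul_snd, map_smul, RingHom.id_apply, smul_eq_mul,
          Prod.smul_mk, inner_sub_right, inner_smul_right]
        ext
        · dsimp only; module
        · dsimp only; ring }
  let φ : X × ℝ × ℝ →ₗ[ℝ] ℝ :=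
    { toFun := fun z => z.2.1 - t * (⟪e, z.1⟫ + z.2.2)
      map_add' := fun z z' => by
        simp only [Prod.fst_add, Prod.snd_add, inner_add_right]; ring
      map_smul' := fun r z => by
        simp only [Prod.smul_fst, Prod.smul_snd, RingHom.id_apply, smul_eq_mul, inner_smul_right]
        ring }
  let a : Fin 2 → X × ℝ × ℝ →ₗ[ℝ] ℝ :=
    ![(LinearMap.fst ℝ ℝ ℝ).comp (LinearMap.snd ℝ X (ℝ × ℝ)),
      (LinearMap.snd ℝ ℝ ℝ).comp (LinearMap.snd ℝ X (ℝ × ℝ))]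
  obtain ⟨s, hs, l, hl, ψ, hid⟩ := farkas_of_mem_intrinsicInterior (LinearMap.fst ℝ X (ℝ × ℝ)) M a
    (dualPC (F : Set X)) φ (es, 1, 1) hes (by simp [M]) (by simp [Fin.forall_fin_succ, a])
    (by
      rintro ⟨x, t', w⟩ hx hM ha
      have ht' : 0 ≤ t' := ha 0
      have hw : 0 ≤ w := ha 1
      have hM1 : A x - t' • A es = 0 := congrArg Prod.fst hM
      have hM2 : -⟪c, x - t' • es⟫ + t' - w = 0 := congrArg Prod.snd hM
      have hex : 0 ≤ ⟪e, x⟫ := hx he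
      change 0 ≤ t' - t * (⟪e, x⟫ + w)
      rcases (add_nonneg hex hw).eq_or_lt' with h0 | hpos
      · rw [h0]; linarith
      · have hinv : 0 ≤ (⟪e, x⟫ + w)⁻¹ := inv_nonneg.2 hpos.le
        have h1 := h ((⟪e, x⟫ + w)⁻¹ • x) ((⟪e, x⟫ + w)⁻¹ * t') ((⟪e, x⟫ + w)⁻¹ * w)
          ⟨?_, ?_, ?_, cone_smul_mem (dualPC (F : Set X)) hx hinv, by positivity, by positivity⟩
        · rw [le_inv_mul_iff₀ hpos] at h1
          linarith
        · rw [mul_smul, ← smul_sub, inner_smul_right]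
          linear_combination (⟪e, x⟫ + w)⁻¹ * hM2
        · rw [inner_smul_right, ← mul_add, inv_mul_cancel₀ hpos.ne']
        · rw [map_smul, mul_smul, ← smul_sub, hM1, smul_zero])
  -- Riesz representation of the multipliers of the equations
  let y₃ : Y := (InnerProductSpace.toDual ℝ Y).symm
    (LinearMap.toContinuousLinearMap (ψ.comp (LinearMap.inl ℝ Y ℝ)))
  have hy₃ : ∀ y, ⟪y₃, y⟫ = ψ (y, 0) := fun y => by simp [y₃]
  have hψ : ∀ y r, ψ (y, r) = ⟪y₃, y⟫ + r * ψ (0, 1) := fun y r => by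
    rw [hy₃, ← smul_eq_mul, ← map_smul, ← map_add]
    simp
  have hid' : ∀ x t' w, t' - t * (⟪e, x⟫ + w) = ⟪s, x⟫ + (l 0 * t' + l 1 * w) + (⟪y₃,
      A x - t' • A es⟫ + (-⟪c, x - t' • es⟫ + t' - w) * ψ (0, 1)) := fun x t' w => by
    have := hid (x, t', w)
    rw [Fin.sum_univ_two] at this
    rw [← hψ]
    exact this
  have hsF : s ∈ F := mem_of_mem_dualCone_dualCone F hs
  refine ⟨ψ (0, 1), t, y₃, ⟨?_, ?_, ?_⟩, le_rfl⟩
  · have : ψ (0, 1) • c - t • e - adj A y₃ = s := by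
      refine ext_inner_right ℝ fun x => ?_
      have h1 := hid' x 0 0
      simp only [zero_smul, sub_zero, add_zero, mul_zero, zero_sub] at h1
      rw [inner_sub_left, inner_sub_left, real_inner_smul_left, real_inner_smul_left,
        LinearMap.adjoint_inner_left]
      linarith
    rw [this]
    exact hsF
  · have h1 := hid' 0 1 0
    simp only [map_zero, inner_zero_right, one_smul, zero_sub, inner_neg_right] at h1
    rw [inner_adj, real_inner_comm y₃]
    linarith [hl 0]
  · have h1 := hid' 0 0 1
    simp only [map_zero, inner_zero_right, zero_smul, sub_zero, zero_sub] at h1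
    linarith [hl 1]

/-- Both auxiliary problems have optimal solutions, and their values agree. -/
theorem exists_isAuxOptimal (A : X →ₗ[ℝ] Y) (c : X) {e es : X} (F : ProperCone ℝ X)
    (he : IsSlaterPoint (F : Set X) e) (hes : es ∈ intrinsicInterior ℝ (dualCone (F : Set X))) :
    ∃ q, IsAuxOptimal A c (F : Set X) e es q ∧ q.t = q.y₂ := by
  set S : Set ℝ := {y₂ | ∃ y₁ y₃, AuxDualFeasible A c (F : Set X) e es y₁ y₂ y₃} with hS
  obtain ⟨x₀, t₀, w₀, h₀⟩ := exists_auxPrimalFeasible A c he.mem (intrinsicInterior_subset hes)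
  have hbdd : BddAbove S := ⟨t₀, by rintro _ ⟨y₁, y₃, hy⟩; exact aux_weak_duality h₀ hy⟩
  have hne : S.Nonempty := ⟨-1, 0, 0, by simpa using he.mem, by simp, by simp⟩
  obtain ⟨x, t, w, hp, hle⟩ := exists_auxPrimal_of_dual_le (F := F.toPointedCone) he (t := sSup S)
    (fun y₁ y₂ y₃ hy => le_csSup hbdd ⟨y₁, y₃, hy⟩)
  have hlow : ∀ x' t' w', AuxPrimalFeasible A c (F : Set X) e es x' t' w' → t ≤ t' :=
    fun x' t' w' h' => hle.trans (csSup_le hne (by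
      rintro _ ⟨y₁, y₃, hy⟩; exact aux_weak_duality h' hy))
  obtain ⟨y₁, y₂, y₃, hd, hty⟩ := exists_auxDual_of_le_primal F he.mem hes hlow
  have heq : t = y₂ := le_antisymm hty (aux_weak_duality hp hd)
  exact ⟨⟨x, t, w, y₁, y₂, y₃⟩, ⟨hp, hlow, hd, fun y₁' y₂' y₃' h' =>
    (aux_weak_duality hp h').trans hty⟩, heq⟩

lemma IsAuxOptimal.t_eq_y₂ {A : X →ₗ[ℝ] Y} {c e es : X} {F : ProperCone ℝ X}
    (he : IsSlaterPoint (F : Set X) e) (hes : es ∈ intrinsicInterior ℝ (dualCone (F : Set X)))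
    {q : AuxPoint X Y} (hq : IsAuxOptimal A c (F : Set X) e es q) : q.t = q.y₂ := by
  obtain ⟨q', hq', heq⟩ := exists_isAuxOptimal A c F he hes
  refine le_antisymm ?_ (aux_weak_duality hq.1 hq.2.2.1)
  calc q.t ≤ q'.t := hq.2.1 _ _ _ hq'.1
    _ = q'.y₂ := heq
    _ ≤ q.y₂ := hq.2.2.2 _ _ _ hq'.2.2.1

/-- Over a polyhedral cone the auxiliary problems are linear programs, so they have strictly
complementary solutions. Tucker's theorem is applied to the homogenized auxiliary dual, with the
optimality of the value as an additional inequality. -/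
theorem exists_isAuxStrict (A : X →ₗ[ℝ] Y) (c : X) {e es : X} (F : ProperCone ℝ X)
    (hF : IsPolyhedral (F : Set X)) (he : e ∈ F)
    (hes : es ∈ intrinsicInterior ℝ (dualCone (F : Set X))) :
    ∃ q, IsAuxStrict A c (F : Set X) e es q := by
  obtain ⟨q, hq, heq⟩ := exists_isAuxOptimal A c F (hF.isSlaterPoint he) hes
  obtain ⟨T, hT⟩ := hF
  have hmemF : ∀ x, x ∈ F ↔ ∀ v ∈ T, 0 ≤ ⟪v, x⟫ := fun x => by
    rw [← SetLike.mem_coe, hT]; rfl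
  have hbound : ∀ y₁ y₂ y₃, AuxDualFeasible A c (F : Set X) e es y₁ y₂ y₃ → y₂ ≤ q.t :=
    fun y₁ y₂ y₃ h => heq ▸ hq.2.2.2 _ _ _ h
  obtain ⟨z, hz, l, hl, hsum, hpos⟩ := tucker (ι := (T ⊕ Fin 3) ⊕ Unit) (Sum.elim
    (Sum.elim (fun v : T => (innerₗ X v.1).comp (auxB A c e)) (auxRow A c es))
    (fun _ => -auxObj Y q.t))
  have hzF : auxB A c e z ∈ F := (hmemF _).2 fun v hv => hz (Sum.inl (Sum.inl ⟨v, hv⟩))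
  have hzrow : ∀ i, 0 ≤ auxRow A c es i z := fun i => hz (Sum.inl (Sum.inr i))
  have hzobj : auxObj Y q.t z = 0 := by
    refine le_antisymm ?_ (auxObj_nonneg (F := F.toPointedCone) he hbound z hzF hzrow)
    simpa using hz (Sum.inr ())
  -- the multiplier of the objective is positive, since the objective vanishes at `z`
  set m := l (Sum.inr ()) with hm
  have hmpos : 0 < m := by
    have := hpos (Sum.inr ())
    simpa [hzobj] using this
  set x : X := m⁻¹ • ∑ v : T, l (Sum.inl (Sum.inl v)) • v.1 with hx
  have hxsum : x = ∑ v : T, (m⁻¹ * l (Sum.inl (Sum.inl v))) • v.1 := by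
    simp only [hx, Finset.smul_sum, smul_smul]
  have hxdual : x ∈ dualCone (F : Set X) := by
    refine cone_smul_mem (dualPC (F : Set X)) ?_ (inv_nonneg.2 hmpos.le)
    refine Submodule.sum_mem _ fun v _ => cone_smul_mem _ (fun s hs => ?_) (hl _)
    rw [innerₗ_apply_apply, real_inner_comm]
    exact (hmemF s).1 hs v.1 v.2
  have hid : ∀ u, auxObj Y q.t u = ⟪x, auxB A c e u⟫
      + ∑ i, (m⁻¹ * l (Sum.inl (Sum.inr i))) * auxRow A c es i u := fun u => by
    have h1 := hsum u
    simp only [Fintype.sum_sum_type, Sum.elim_inl, Sum.elim_inr, LinearMap.comp_apply,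
      innerₗ_apply_apply, LinearMap.neg_apply, Finset.univ_unique, Finset.sum_singleton] at h1
    have h2 : ∀ i, m⁻¹ * l (Sum.inl (Sum.inr i)) * auxRow A c es i u
        = m⁻¹ * (l (Sum.inl (Sum.inr i)) * auxRow A c es i u) := fun i => mul_assoc _ _ _
    rw [hx, real_inner_smul_left, sum_inner, Finset.sum_congr rfl fun i _ => h2 i,
      ← Finset.mul_sum, ← mul_add, eq_inv_mul_iff_mul_eq₀ hmpos.ne']
    simp only [real_inner_smul_left]
    have h3 : l (Sum.inr default) = m := rfl
    rw [h3] at h1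
    linarith
  obtain ⟨hp, ht⟩ := auxPrimalFeasible_of_identity hxdual
    (fun i => mul_nonneg (inv_nonneg.2 hmpos.le) (hl _)) hid
  have htle := hq.2.1 _ _ _ hp
  -- the multiplier of `τ ≥ 0` vanishes, hence `τ > 0` at `z`
  have hl0 : l (Sum.inl (Sum.inr 0)) = 0 := by
    have h0 : 0 ≤ m⁻¹ * l (Sum.inl (Sum.inr 0)) := mul_nonneg (inv_nonneg.2 hmpos.le) (hl _)
    have h1 : m⁻¹ * l (Sum.inl (Sum.inr 0)) = 0 := by linarith
    exact (mul_eq_zero.1 h1).resolve_left (inv_ne_zero hmpos.ne')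
  obtain ⟨y₁, y₂, y₃, τ⟩ := z
  have hτ : 0 < τ := by
    have h1 := hpos (Sum.inl (Sum.inr 0))
    rw [hl0, zero_add] at h1
    exact h1
  have hτi : 0 < τ⁻¹ := inv_pos.2 hτ
  have hobj : q.t * τ - y₂ = 0 := hzobj
  have hty : q.t = τ⁻¹ * y₂ := by
    rw [sub_eq_zero.1 hobj |>.symm]; field_simp
  have hlm : ∀ i (a : ℝ), 0 ≤ a → 0 < l (Sum.inl i) + a → 0 < m⁻¹ * l (Sum.inl i) + τ⁻¹ * a :=
    fun i a ha hla => by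
      rcases (hl (Sum.inl i)).eq_or_lt' with h0 | h0
      · rw [h0] at hla ⊢
        have : 0 < a := by linarith
        positivity
      · positivity
  have hslack : (τ⁻¹ * y₁) • c - (τ⁻¹ * y₂) • e - adj A (τ⁻¹ • y₃)
      = τ⁻¹ • (y₁ • c - y₂ • e - adj A y₃) := by
    simp only [map_smul]
    module
  have hσ : 1 - τ⁻¹ * y₁ * (1 + ⟪c, es⟫) + ⟪es, adj A (τ⁻¹ • y₃)⟫
      = τ⁻¹ * (τ - y₁ * (1 + ⟪c, es⟫) + ⟪es, adj A y₃⟫) := by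
    simp only [map_smul, inner_smul_right]
    linear_combination (-1 : ℝ) * inv_mul_cancel₀ hτ.ne'
  have hsF : τ⁻¹ • (y₁ • c - y₂ • e - adj A y₃) ∈ F := cone_smul_mem F.toPointedCone hzF hτi.le
  have hd : AuxDualFeasible A c (F : Set X) e es (τ⁻¹ * y₁) (τ⁻¹ * y₂) (τ⁻¹ • y₃) := by
    refine ⟨hslack ▸ hsF, ?_, ?_⟩
    · rw [hσ]; exact mul_nonneg hτi.le (hzrow 1)
    · rw [← mul_sub]; exact mul_nonneg hτi.le (hzrow 2)
  have htt : q.t = m⁻¹ * l (Sum.inl (Sum.inr 1)) := by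
    rw [hl0, mul_zero, zero_add] at ht
    exact ht
  refine ⟨⟨x, m⁻¹ * l (Sum.inl (Sum.inr 1)), m⁻¹ * l (Sum.inl (Sum.inr 2)), τ⁻¹ * y₁, τ⁻¹ * y₂,
    τ⁻¹ • y₃⟩, ⟨hp, fun x' t' w' h' => htt ▸ hq.2.1 _ _ _ h', hd, fun y₁' y₂' y₃' h' =>
      hty ▸ hbound _ _ _ h'⟩, htt.symm.trans hty, ?_, ?_, ?_⟩
  · dsimp only
    rw [hslack, hxsum]
    refine mem_intrinsicInterior_of_strict F T hmemF _
      (fun v => mul_nonneg (inv_nonneg.2 hmpos.le) (hl _)) hsF ?_ fun v => ?_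
    · rw [← hxsum]
      have h1 := aux_gap hp (τ⁻¹ * y₁) (τ⁻¹ * y₂) (τ⁻¹ • y₃)
      have h2 : 0 ≤ ⟪x, τ⁻¹ • (y₁ • c - y₂ • e - adj A y₃)⟫ := by
        rw [real_inner_comm]; exact hxdual hsF
      have h3 := mul_nonneg hp.2.2.2.2.1 hd.2.1
      have h4 := mul_nonneg hp.2.2.2.2.2 hd.2.2
      rw [hslack] at h1
      linarith
    · rw [inner_smul_right]
      exact hlm (Sum.inl v) _ ((hmemF _).1 hzF v.1 v.2) (hpos (Sum.inl (Sum.inl v)))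
  · dsimp only
    rw [hσ]
    exact hlm _ _ (hzrow 1) (hpos (Sum.inl (Sum.inr 1)))
  · dsimp only
    rw [← mul_sub]
    exact hlm _ _ (hzrow 2) (hpos (Sum.inl (Sum.inr 2)))

end Duality

/-! ### The distance to polyhedrality -/

section DistPoly

variable {X : Type*} [NormedAddCommGroup X] [InnerProductSpace ℝ X] [FiniteDimensional ℝ X]

lemma isPolyhedral_submodule (U : Submodule ℝ X) : IsPolyhedral (U : Set X) := by
  classical
  obtain ⟨S, hS⟩ := (IsNoetherian.noetherian Uᗮ : Uᗮ.FG)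
  refine ⟨S ∪ S.image (fun v => -v), Set.ext fun x => ⟨fun hx v hv => ?_, fun hx => ?_⟩⟩
  · have horth : ∀ v ∈ S, ⟪v, x⟫ = 0 := fun v hv =>
      Submodule.inner_left_of_mem_orthogonal hx (hS ▸ Submodule.subset_span hv)
    rcases Finset.mem_union.1 hv with hv | hv
    · exact (horth v hv).ge
    · obtain ⟨u, hu, rfl⟩ := Finset.mem_image.1 hv
      rw [inner_neg_left, horth u hu, neg_zero]
  · rw [SetLike.mem_coe, ← Submodule.orthogonal_orthogonal U, ← hS, Submodule.mem_orthogonal]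
    intro u hu
    induction hu using Submodule.span_induction with
    | mem v hv =>
      refine le_antisymm ?_ (hx v (Finset.mem_union_left _ hv))
      have := hx (-v) (Finset.mem_union_right _ (Finset.mem_image_of_mem _ hv))
      rwa [inner_neg_left, Left.nonneg_neg_iff] at this
    | zero => exact inner_zero_left _
    | add u v _ _ hu hv => rw [inner_add_left, hu, hv, add_zero]
    | smul a u _ hu => rw [real_inner_smul_left, hu, mul_zero]

/-- The lineality space of a cone. -/
def linealitySpace (C : PointedCone ℝ X) : Submodule ℝ X where
  carrier := {x | x ∈ C ∧ -x ∈ C}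
  add_mem' := fun {x y} hx hy => ⟨C.add_mem hx.1 hy.1, by
    rw [neg_add]; exact C.add_mem hx.2 hy.2⟩
  zero_mem' := ⟨C.zero_mem, by rw [neg_zero]; exact C.zero_mem⟩
  smul_mem' := fun a x hx => by
    rcases le_total 0 a with ha | ha
    · exact ⟨cone_smul_mem C hx.1 ha, by rw [← smul_neg]; exact cone_smul_mem C hx.2 ha⟩
    · refine ⟨?_, by rw [← neg_smul]; exact cone_smul_mem C hx.1 (neg_nonneg.2 ha)⟩
      rw [← neg_smul_neg]
      exact cone_smul_mem C hx.2 (neg_nonneg.2 ha)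

omit [FiniteDimensional ℝ X] in
lemma isFace_linealitySpace (C : PointedCone ℝ X) :
    IsFace (C : Set X) (linealitySpace C : Set X) := by
  refine ⟨⟨fun x hx => hx.1, ?_⟩, (linealitySpace C).convex⟩
  rintro x hx y hy z hz ⟨a, b, ha, hb, -, rfl⟩
  refine ⟨hx, ?_⟩
  -- `-x` is a nonnegative combination of `-(a x + b y)` and `y`
  have h1 := cone_smul_mem C (C.add_mem hz.2 (cone_smul_mem C hy hb.le)) (inv_nonneg.2 ha.le)
  rwa [neg_add, neg_add_cancel_right, smul_neg, smul_smul, inv_mul_cancel₀ ha.ne',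
    one_smul] at h1

lemma hasPolyChain_zero (C : PointedCone ℝ X) : HasPolyChain (C : Set X) 0 :=
  have : Subsingleton (Fin (0 + 1)) := Fin.subsingleton_one
  ⟨fun _ => linealitySpace C, Subsingleton.strictMono _,
    fun _ => ⟨isFace_linealitySpace C, ⟨0, (linealitySpace C).zero_mem⟩⟩,
    isPolyhedral_submodule _, fun i hi => absurd (Subsingleton.elim i 0) hi⟩

/-- The spans of the faces in a chain have increasing dimensions. -/
lemma HasPolyChain.le_finrank (C : PointedCone ℝ X) {n : ℕ} (h : HasPolyChain (C : Set X) n) :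
    n ≤ Module.finrank ℝ X := by
  obtain ⟨F, hmono, hface, -, -⟩ := h
  have hle : ∀ i : Fin (n + 1), (i : ℕ) ≤ Module.finrank ℝ (Submodule.span ℝ (F i)) := by
    intro i
    induction i using Fin.induction with
    | zero => exact Nat.zero_le _
    | succ i ih =>
      have hlt : F i.castSucc < F i.succ := hmono i.castSucc_lt_succ
      have hspan : Submodule.span ℝ (F i.castSucc) < Submodule.span ℝ (F i.succ) :=
        lt_of_le_not_ge (Submodule.span_mono hlt.le) fun hge => hlt.not_ge
          (face_subset_of_span_le C (hface _).1 (hface _).2 (hface _).1 hge)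
      have := Submodule.finrank_lt_finrank_of_lt hspan
      simp only [Fin.val_castSucc] at ih
      rw [Fin.val_succ]
      omega
  simpa using (hle (Fin.last n)).trans (Submodule.finrank_le _)

lemma bddAbove_hasPolyChain (C : PointedCone ℝ X) : BddAbove {n | HasPolyChain (C : Set X) n} :=
  ⟨_, fun _ h => HasPolyChain.le_finrank C h⟩

lemma hasPolyChain_distPoly (C : PointedCone ℝ X) : HasPolyChain (C : Set X) (distPoly (C : Set X)) :=
  Nat.sSup_mem ⟨0, hasPolyChain_zero C⟩ (bddAbove_hasPolyChain C)

lemma distPoly_mono (C G : PointedCone ℝ X) (hG : IsFace (C : Set X) (G : Set X)) :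
    distPoly (G : Set X) ≤ distPoly (C : Set X) := by
  refine le_csSup (bddAbove_hasPolyChain C) ?_
  obtain ⟨F, hmono, hface, h0, h1⟩ := hasPolyChain_distPoly G
  exact ⟨F, hmono, fun i => ⟨hG.trans (hface i).1, (hface i).2⟩, h0, h1⟩

/-- A chain for a proper face of a nonpolyhedral cone is prolonged by the cone itself. -/
lemma distPoly_lt (C G : PointedCone ℝ X) (hG : IsFace (C : Set X) (G : Set X))
    (hne : (G : Set X) ≠ C) (hC : ¬ IsPolyhedral (C : Set X)) :
    distPoly (G : Set X) < distPoly (C : Set X) := by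
  refine Nat.succ_le_iff.1 (le_csSup (bddAbove_hasPolyChain C) ?_)
  obtain ⟨F, hmono, hface, h0, h1⟩ := hasPolyChain_distPoly G
  refine ⟨Fin.snoc (α := fun _ => Set X) F (C : Set X), ?_, fun i => ?_, ?_, fun i => ?_⟩
  · refine Fin.strictMono_iff_lt_succ.2 fun i => ?_
    induction i using Fin.lastCases with
    | last =>
      rw [Fin.succ_last, Fin.snoc_last, Fin.snoc_castSucc]
      exact lt_of_le_of_lt (hface _).1.1.subset (hG.1.subset.ssubset_of_ne hne)
    | cast i =>
      rw [Fin.succ_castSucc, Fin.snoc_castSucc, Fin.snoc_castSucc]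
      exact hmono i.castSucc_lt_succ
  · induction i using Fin.lastCases with
    | last =>
      rw [Fin.snoc_last]
      exact ⟨isFace_refl C, ⟨0, C.zero_mem⟩⟩
    | cast i =>
      rw [Fin.snoc_castSucc]
      exact ⟨hG.trans (hface i).1, (hface i).2⟩
  · have : (0 : Fin (distPoly (G : Set X) + 1 + 1)) = Fin.castSucc 0 := rfl
    rw [this, Fin.snoc_castSucc]
    exact h0
  · induction i using Fin.lastCases with
    | last => intro _; rwa [Fin.snoc_last]
    | cast i =>
      intro hi
      rw [Fin.snoc_castSucc]
      exact h1 i fun h => hi (by rw [h]; rfl)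

end DistPoly

/-! ### Product cones -/

section Product

variable {r : ℕ} {E : Fin r → Type*} [∀ j, NormedAddCommGroup (E j)]

/-- The vector of the product space with the block `v` at `j` and zeros elsewhere. -/
def blockSingle (j : Fin r) (v : E j) : PiLp 2 E := WithLp.toLp 2 (Pi.single j v)

lemma blockSingle_same (j : Fin r) (v : E j) : (blockSingle j v : PiLp 2 E) j = v := by
  simp [blockSingle]

lemma blockSingle_ne {j k : Fin r} (h : k ≠ j) (v : E j) : (blockSingle j v : PiLp 2 E) k = 0 := by
  simp [blockSingle, h]

variable [∀ j, InnerProductSpace ℝ (E j)]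

lemma inner_blockSingle (j : Fin r) (v : E j) (x : PiLp 2 E) : ⟪blockSingle j v, x⟫ = ⟪v, x j⟫ := by
  rw [PiLp.inner_apply, Finset.sum_eq_single j, blockSingle_same]
  · intro k _ hk
    rw [blockSingle_ne hk, inner_zero_left]
  · simp

lemma blockSingle_mem_prodCone (K : ∀ j, ProperCone ℝ (E j)) {j : Fin r} {v : E j} (hv : v ∈ K j) :
    blockSingle j v ∈ prodCone K := by
  intro k
  by_cases h : k = j
  · subst h
    rwa [blockSingle_same]
  · rw [blockSingle_ne h]
    exact (K k).toPointedCone.zero_mem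

/-- The product cone, as a closed convex cone. -/
def prodPC (K : ∀ j, ProperCone ℝ (E j)) : ProperCone ℝ (PiLp 2 E) where
  carrier := prodCone K
  add_mem' := fun hx hy j => (K j).toPointedCone.add_mem (hx j) (hy j)
  zero_mem' := fun j => (K j).toPointedCone.zero_mem
  smul_mem' := fun a _ hx j => cone_smul_mem (K j).toPointedCone (hx j) a.2
  isClosed' := by
    have : prodCone K = ⋂ j, (fun x : PiLp 2 E => x j) ⁻¹' (K j : Set (E j)) := by
      ext x; simp [prodCone]
    rw [this]
    exact isClosed_iInter fun j => (K j).isClosed.preimage (by fun_prop)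

lemma block_prodCone (K : ∀ j, ProperCone ℝ (E j)) (j : Fin r) : block (prodCone K) j = K j := by
  refine Set.ext fun v => ⟨?_, fun hv => ⟨blockSingle j v, blockSingle_mem_prodCone K hv,
    blockSingle_same j v⟩⟩
  rintro ⟨x, hx, rfl⟩
  exact hx j

lemma mem_dualCone_prodCone (K : ∀ j, ProperCone ℝ (E j)) {x : PiLp 2 E} :
    x ∈ dualCone (prodCone K) ↔ ∀ j, x j ∈ dualCone (K j : Set (E j)) := by
  constructor
  · intro h j v hv
    have := h (blockSingle_mem_prodCone K hv)
    rwa [innerₗ_apply_apply, inner_blockSingle] at this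
  · intro h s hs
    rw [innerₗ_apply_apply, PiLp.inner_apply]
    exact Finset.sum_nonneg fun j _ => h j (hs j)

lemma prodCone_inter_perp (K : ∀ j, ProperCone ℝ (E j)) {x : PiLp 2 E}
    (hx : x ∈ dualCone (prodCone K)) :
    prodCone K ∩ perp {x} = prodCone (fun j => hyperplaneSection (K j) (x j)) := by
  rw [mem_dualCone_prodCone] at hx
  refine Set.ext fun s => ⟨fun hs j => ⟨hs.1 j, ?_⟩, fun hs => ⟨fun j => (hs j).1, ?_⟩⟩
  · have h1 := mem_perp_singleton.1 hs.2
    rw [PiLp.inner_apply, Finset.sum_eq_zero_iff_of_nonneg fun j _ => by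
      rw [real_inner_comm]; exact hx j (hs.1 j)] at h1
    exact mem_perp_singleton.2 (h1 j (Finset.mem_univ j))
  · rw [mem_perp_singleton, PiLp.inner_apply]
    exact Finset.sum_eq_zero fun j _ => mem_perp_singleton.1 (hs j).2

lemma isPolyhedral_prodCone (K : ∀ j, ProperCone ℝ (E j))
    (h : ∀ j, IsPolyhedral (K j : Set (E j))) : IsPolyhedral (prodCone K) := by
  classical
  choose T hT using h
  refine ⟨Finset.univ.biUnion fun j => (T j).image (blockSingle j), Set.ext fun x => ?_⟩
  have hmem : ∀ j, x j ∈ K j ↔ ∀ v ∈ T j, 0 ≤ ⟪v, x j⟫ := fun j => by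
    rw [← SetLike.mem_coe, hT j]; rfl
  constructor
  · intro hx a ha
    obtain ⟨j, -, ha⟩ := Finset.mem_biUnion.1 ha
    obtain ⟨v, hv, rfl⟩ := Finset.mem_image.1 ha
    rw [inner_blockSingle]
    exact (hmem j).1 (hx j) v hv
  · intro hx j
    refine (hmem j).2 fun v hv => ?_
    rw [← inner_blockSingle]
    exact hx _ (Finset.mem_biUnion.2 ⟨j, Finset.mem_univ j, Finset.mem_image_of_mem _ hv⟩)

variable [∀ j, FiniteDimensional ℝ (E j)]

lemma mem_intrinsicInterior_prodCone (K : ∀ j, ProperCone ℝ (E j)) {x : PiLp 2 E} :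
    x ∈ intrinsicInterior ℝ (prodCone K) ↔ ∀ j, x j ∈ intrinsicInterior ℝ (K j : Set (E j)) := by
  have hprod := mem_intrinsicInterior_cone_iff (prodPC K).toPointedCone (x := x)
  have hK := fun j => mem_intrinsicInterior_cone_iff (K j).toPointedCone (x := x j)
  refine hprod.trans ⟨fun h j => (hK j).2 ⟨h.1 j, fun v hv => ?_⟩, fun h => ?_⟩
  · obtain ⟨ε, hε, h'⟩ := h.2 _ (blockSingle_mem_prodCone K hv)
    have := h' j
    rw [PiLp.sub_apply, PiLp.smul_apply, blockSingle_same] at this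
    exact ⟨ε, hε, this⟩
  · have h' := fun j => (hK j).1 (h j)
    refine ⟨fun j => (h' j).1, fun s hs => ?_⟩
    choose ε hε hmem using fun j => (h' j).2 (s j) (hs j)
    obtain ⟨δ, hδ, hδle⟩ := exists_pos_forall_le ε hε
    refine ⟨δ, hδ, fun j => ?_⟩
    -- a convex combination of `x j` and `x j - ε j • s j`
    have h1 : x j - δ • s j = (1 - δ / ε j) • x j + (δ / ε j) • (x j - ε j • s j) := by
      have h2 : δ = δ / ε j * ε j := (div_mul_cancel₀ _ (hε j).ne').symm
      nth_rewrite 1 [h2]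
      module
    rw [PiLp.sub_apply, PiLp.smul_apply, h1]
    exact (K j).toPointedCone.add_mem
      (cone_smul_mem _ (h' j).1 (sub_nonneg.2 ((div_le_one (hε j)).2 (hδle j))))
      (cone_smul_mem _ (hmem j) (div_nonneg hδ.le (hε j).le))

/-- A product cone satisfies the partial polyhedral Slater condition at each of its points whose
nonpolyhedral blocks are relative interior points. -/
lemma isSlaterPoint_prodCone (K : ∀ j, ProperCone ℝ (E j)) {e : PiLp 2 E} (he : e ∈ prodCone K)
    (h : ∀ j, ¬ IsPolyhedral (K j : Set (E j)) → e j ∈ intrinsicInterior ℝ (K j : Set (E j))) :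
    IsSlaterPoint (prodCone K) e := by
  classical
  have htop : ∀ j, IsPolyhedral ((⊤ : ProperCone ℝ (E j)) : Set (E j)) := fun j => ⟨∅, by simp⟩
  let K₁ : ∀ j, ProperCone ℝ (E j) := fun j => if IsPolyhedral (K j : Set (E j)) then K j else ⊤
  let K₂ : ∀ j, ProperCone ℝ (E j) := fun j => if IsPolyhedral (K j : Set (E j)) then ⊤ else K j
  have hle₁ : ∀ j, ∀ v ∈ K j, v ∈ K₁ j := fun j v hv => by
    dsimp only [K₁]; split_ifs
    · exact hv
    · exact ClosedSubmodule.mem_top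
  have hle₂ : ∀ j, ∀ v ∈ K j, v ∈ K₂ j := fun j v hv => by
    dsimp only [K₂]; split_ifs
    · exact ClosedSubmodule.mem_top
    · exact hv
  obtain ⟨T, hT⟩ := isPolyhedral_prodCone K₁ fun j => by
    dsimp only [K₁]; split_ifs with hj
    · exact hj
    · exact htop j
  have hmem₁ : ∀ x, (∀ a ∈ T, 0 ≤ ⟪a, x⟫) ↔ x ∈ prodCone K₁ := fun x => by rw [hT]; rfl
  refine ⟨T, (prodPC K₂).toPointedCone, Set.ext fun x => ?_,
    (hmem₁ e).2 fun j => hle₁ j _ (he j), ?_⟩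
  · change _ ↔ (∀ a ∈ T, 0 ≤ ⟪a, x⟫) ∧ x ∈ prodCone K₂
    rw [hmem₁]
    refine ⟨fun hx => ⟨fun j => hle₁ j _ (hx j), fun j => hle₂ j _ (hx j)⟩, fun hx j => ?_⟩
    have h1 := hx.1 j
    have h2 := hx.2 j
    dsimp only [K₁, K₂] at h1 h2
    split_ifs at h1 h2 with hj
    · exact h1
    · exact h2
  · refine (mem_intrinsicInterior_prodCone K₂).2 fun j => ?_
    dsimp only [K₂]
    split_ifs with hj
    · exact interior_subset_intrinsicInterior (by simp)
    · exact h j hj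

/-- The linear span of a closed convex cone, as a closed convex cone. -/
def spanCone {X : Type*} [NormedAddCommGroup X] [InnerProductSpace ℝ X] [FiniteDimensional ℝ X]
    (C : ProperCone ℝ X) : ProperCone ℝ X where
  carrier := Submodule.span ℝ (C : Set X)
  add_mem' := Submodule.add_mem _
  zero_mem' := Submodule.zero_mem _
  smul_mem' := fun a _ hx => Submodule.smul_mem _ (a : ℝ) hx
  isClosed' := Submodule.closed_of_finiteDimensional _

open Classical in
/-- The blocks of the relaxed cone of a product cone. -/
def relaxedBlock (K : ∀ j, ProperCone ℝ (E j)) (j : Fin r) : ProperCone ℝ (E j) :=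
  if IsPolyhedral (K j : Set (E j)) then K j else spanCone (K j)

lemma relaxedBlock_of_isPolyhedral (K : ∀ j, ProperCone ℝ (E j)) {j : Fin r}
    (h : IsPolyhedral (K j : Set (E j))) : relaxedBlock K j = K j := if_pos h

lemma relaxedBlock_of_not_isPolyhedral (K : ∀ j, ProperCone ℝ (E j)) {j : Fin r}
    (h : ¬ IsPolyhedral (K j : Set (E j))) : relaxedBlock K j = spanCone (K j) := if_neg h

lemma relaxedCone_prodCone (K : ∀ j, ProperCone ℝ (E j)) :
    relaxedCone (prodCone K) = prodCone (relaxedBlock K) := by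
  refine Set.ext fun x => forall_congr' fun j => ?_
  rw [block_prodCone]
  by_cases h : IsPolyhedral (K j : Set (E j))
  · simp [relaxedBlock_of_isPolyhedral K h, h]
  · rw [relaxedBlock_of_not_isPolyhedral K h]
    simp only [h, false_implies, not_false_eq_true, true_implies, true_and]
    rfl

lemma isPolyhedral_relaxedBlock (K : ∀ j, ProperCone ℝ (E j)) (j : Fin r) :
    IsPolyhedral (relaxedBlock K j : Set (E j)) := by
  by_cases h : IsPolyhedral (K j : Set (E j))
  · rwa [relaxedBlock_of_isPolyhedral K h]
  · rw [relaxedBlock_of_not_isPolyhedral K h]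
    exact isPolyhedral_submodule (Submodule.span ℝ (K j : Set (E j)))

lemma le_relaxedBlock (K : ∀ j, ProperCone ℝ (E j)) (j : Fin r) {v : E j} (hv : v ∈ K j) :
    v ∈ relaxedBlock K j := by
  by_cases h : IsPolyhedral (K j : Set (E j))
  · rwa [relaxedBlock_of_isPolyhedral K h]
  · rw [relaxedBlock_of_not_isPolyhedral K h]
    exact Submodule.subset_span hv

lemma relaxedBlock_subset_span (K : ∀ j, ProperCone ℝ (E j)) (j : Fin r) {v : E j}
    (hv : v ∈ relaxedBlock K j) : v ∈ Submodule.span ℝ (K j : Set (E j)) := by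
  by_cases h : IsPolyhedral (K j : Set (E j))
  · rw [relaxedBlock_of_isPolyhedral K h] at hv
    exact Submodule.subset_span hv
  · rwa [relaxedBlock_of_not_isPolyhedral K h] at hv

end Product

/-! ### Facial reduction and auxiliary solutions -/

section Reduction

variable {X Y : Type*} [NormedAddCommGroup X] [InnerProductSpace ℝ X] [FiniteDimensional ℝ X]
  [NormedAddCommGroup Y] [InnerProductSpace ℝ Y] [FiniteDimensional ℝ Y]

/-- A direction `d` with `A d = 0` has the same inner product with all vectors `c - Aᵀ y`. -/
lemma inner_slack_of_ker {A : X →ₗ[ℝ] Y} {c d : X} (hd : A d = 0) (y : Y) :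
    ⟪d, c - adj A y⟫ = ⟪c, d⟫ := by
  rw [inner_sub_adj, hd, inner_zero_left, sub_zero]

lemma slacks_congr {A : X →ₗ[ℝ] Y} {c : X} {F G : Set X}
    (h : ∀ y, c - adj A y ∈ F ↔ c - adj A y ∈ G) : slacks A c F = slacks A c G := by
  refine Set.ext fun s => ⟨?_, ?_⟩
  · rintro ⟨hs, y, rfl⟩
    exact ⟨(h y).1 hs, y, rfl⟩
  · rintro ⟨hs, y, rfl⟩
    exact ⟨(h y).2 hs, y, rfl⟩

lemma slacks_eq_empty_of_direction {A : X →ₗ[ℝ] Y} {c d : X} {F : Set X}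
    (hd : IsInfeasDirection A c F d) : slacks A c F = ∅ := by
  refine Set.eq_empty_of_forall_notMem ?_
  rintro s ⟨hs, y, rfl⟩
  have h1 := hd.1 hs
  rw [innerₗ_apply_apply, real_inner_comm, inner_slack_of_ker hd.2.1] at h1
  exact absurd hd.2.2 (not_lt.2 h1)

/-- No reducing direction is left once a feasible slack lies in the relative interior. -/
lemma no_direction_of_mem_intrinsicInterior {A : X →ₗ[ℝ] Y} {c : X} (G : PointedCone ℝ X) {s : X}
    (hs : s ∈ slacks A c (G : Set X)) (hri : s ∈ intrinsicInterior ℝ (G : Set X)) :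
    ¬ ∃ d, IsProperDirection A c (G : Set X) d ∨ IsInfeasDirection A c (G : Set X) d := by
  rintro ⟨d, hd | hd⟩
  · obtain ⟨hdual, hA, hperp, hc⟩ := hd
    obtain ⟨-, y, rfl⟩ := hs
    refine hperp fun u hu => ?_
    obtain ⟨ε, hε, h⟩ := ((mem_intrinsicInterior_cone_iff G).1 hri).2 u hu
    have h1 : 0 ≤ ⟪u, d⟫ := hdual hu
    have h2 := hdual h
    rw [innerₗ_apply_apply, inner_sub_left, real_inner_comm, inner_slack_of_ker hA, hc,
      real_inner_smul_left] at h2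
    nlinarith
  · rw [slacks_eq_empty_of_direction hd] at hs
    exact hs

omit [FiniteDimensional ℝ X] [FiniteDimensional ℝ Y] in
lemma AuxPrimalFeasible.ker_of_t_eq_zero {A : X →ₗ[ℝ] Y} {c e es x : X} {F : Set X} {t w : ℝ}
    (h : AuxPrimalFeasible A c F e es x t w) (ht : t = 0) : A x = 0 ∧ ⟪c, x⟫ = -w := by
  obtain ⟨h1, -, h3, -⟩ := h
  subst ht
  simp only [zero_smul, sub_zero, add_zero] at h1 h3
  exact ⟨h3, by linarith⟩

lemma auxSlack_eq {A : X →ₗ[ℝ] Y} {c e : X} {q : AuxPoint X Y} (h : 0 < q.y₁) :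
    auxSlack A c q
      = q.y₁⁻¹ • (q.y₁ • c - q.y₂ • e - adj A q.y₃) + (q.y₁⁻¹ * q.y₂) • e := by
  have h1 : c = q.y₁⁻¹ • q.y₁ • c := by rw [smul_smul, inv_mul_cancel₀ h.ne', one_smul]
  rw [auxSlack, map_smul]
  nth_rewrite 1 [h1]
  module

end Reduction

section Poly

variable {r : ℕ} {E : Fin r → Type*} [∀ j, NormedAddCommGroup (E j)]
  [∀ j, InnerProductSpace ℝ (E j)] [∀ j, FiniteDimensional ℝ (E j)]
  {Y : Type*} [NormedAddCommGroup Y] [InnerProductSpace ℝ Y] [FiniteDimensional ℝ Y]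

/-! ### Phase 1 -/

omit [∀ j, FiniteDimensional ℝ (E j)] in
lemma Phase1Params.mem {K : ∀ j, ProperCone ℝ (E j)} {e es : PiLp 2 E}
    (h : Phase1Params (prodCone K) e es) : e ∈ prodCone K := fun j => by
  have hj := h.2 j
  rw [block_prodCone] at hj
  by_cases hp : IsPolyhedral (K j : Set (E j))
  · rw [hj.1 hp]
    exact (K j).toPointedCone.zero_mem
  · exact intrinsicInterior_subset (hj.2 hp)

lemma Phase1Params.isSlaterPoint {K : ∀ j, ProperCone ℝ (E j)} {e es : PiLp 2 E}
    (h : Phase1Params (prodCone K) e es) : IsSlaterPoint (prodCone K) e :=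
  isSlaterPoint_prodCone K h.mem fun j hj => by
    have := (h.2 j).2
    rw [block_prodCone] at this
    exact this hj

lemma exists_phase1Params (K : ∀ j, ProperCone ℝ (E j)) :
    ∃ e es, Phase1Params (prodCone K) e es := by
  classical
  obtain ⟨es, hes⟩ := Set.Nonempty.intrinsicInterior (dualPC (prodCone K)).convex
    ⟨0, (dualPC (prodCone K)).zero_mem⟩
  choose v hv using fun j => Set.Nonempty.intrinsicInterior (K j).convex (K j).nonempty
  refine ⟨WithLp.toLp 2 fun j => if IsPolyhedral (K j : Set (E j)) then 0 else v j, es, hes,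
    fun j => ?_⟩
  rw [block_prodCone]
  refine ⟨fun h => by simp [h], fun h => ?_⟩
  simpa [h] using hv j

/-- At a replacement in Phase 1 the direction is proper, and the total distance to polyhedrality
drops, since some nonpolyhedral block is replaced by a proper face. -/
lemma phase1_step {A : PiLp 2 E →ₗ[ℝ] Y} {c : PiLp 2 E} {K : ∀ j, ProperCone ℝ (E j)}
    {q : AuxPoint (PiLp 2 E) Y} (hq : Phase1Solution A c (prodCone K) q) (ht : q.t = 0)
    (hc : ⟪c, q.x⟫ = 0) :
    IsProperDirection A c (prodCone K) q.x ∧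
      ∑ j, distPoly (hyperplaneSection (K j) (q.x j) : Set (E j))
        < ∑ j, distPoly (K j : Set (E j)) := by
  obtain ⟨e, es, hpar, hopt⟩ := hq
  obtain ⟨hA, hw⟩ := hopt.1.ker_of_t_eq_zero ht
  have hdual : q.x ∈ dualCone (prodCone K) := hopt.1.2.2.2.1
  have hex : ⟪e, q.x⟫ = 1 := by
    have := hopt.1.2.1
    linarith
  refine ⟨⟨hdual, hA, fun h => ?_, hc⟩, ?_⟩
  · have := h e hpar.mem
    linarith
  · have hdualj := (mem_dualCone_prodCone K).1 hdual
    refine Finset.sum_lt_sum (fun j _ => distPoly_mono (K j).toPointedCone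
      (hyperplaneSection (K j) (q.x j)).toPointedCone
      (isFace_inter_perp (K j).toPointedCone (hdualj j))) ?_
    obtain ⟨j, -, hj⟩ : ∃ j ∈ Finset.univ, ⟪e j, q.x j⟫ ≠ 0 := by
      refine Finset.exists_ne_zero_of_sum_ne_zero ?_
      rw [← PiLp.inner_apply, hex]
      exact one_ne_zero
    have hparj := hpar.2 j
    rw [block_prodCone] at hparj
    have hnp : ¬ IsPolyhedral (K j : Set (E j)) := fun hp => hj (by
      rw [hparj.1 hp, inner_zero_left])
    refine ⟨j, Finset.mem_univ j, distPoly_lt (K j).toPointedCone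
      (hyperplaneSection (K j) (q.x j)).toPointedCone
      (isFace_inter_perp (K j).toPointedCone (hdualj j)) (fun heq => ?_) hnp⟩
    have hmem : e j ∈ ((hyperplaneSection (K j) (q.x j)).toPointedCone : Set (E j)) := by
      rw [heq]
      exact hpar.mem j
    exact hj (by rw [real_inner_comm]; exact mem_perp_singleton.1 hmem.2)

/-- The invariant of Phase 1: the current face is a product cone and a face of the original cone, it
contains the same slacks, and the number of steps is paid for by the total distance to
polyhedrality. -/
lemma Phase1Reaches.invariant {A : PiLp 2 E →ₗ[ℝ] Y} {c : PiLp 2 E} {K : ∀ j, ProperCone ℝ (E j)}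
    {ds : List (PiLp 2 E)} {F : Set (PiLp 2 E)} (h : Phase1Reaches A c (prodCone K) ds F) :
    ReducesTo A c (prodCone K) ds F ∧ ∃ L : ∀ j, ProperCone ℝ (E j), F = prodCone L ∧
      IsFace (prodCone K) (prodCone L) ∧
      ds.length + ∑ j, distPoly (L j : Set (E j)) ≤ ∑ j, distPoly (K j : Set (E j)) ∧
      ∀ y, c - adj A y ∈ prodCone K ↔ c - adj A y ∈ prodCone L := by
  induction h with
  | start => exact ⟨.start, K, rfl, isFace_refl (prodPC K).toPointedCone, by simp, fun _ => Iff.rfl⟩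
  | step _ hq ht hc ih =>
    obtain ⟨hred, L, rfl, hface, hlen, hslack⟩ := ih
    obtain ⟨hdir, hlt⟩ := phase1_step hq ht hc
    have hsec := prodCone_inter_perp L hdir.1
    refine ⟨hred.step hdir, _, hsec, ?_, ?_, fun y => (hslack y).trans ?_⟩
    · rw [← hsec]
      exact hface.trans (isFace_inter_perp (prodPC L).toPointedCone hdir.1)
    · rw [List.length_append, List.length_singleton]
      omega
    · rw [← hsec]
      refine ⟨fun h => ⟨h, ?_⟩, fun h => h.1⟩
      rw [mem_perp_singleton, inner_slack_of_ker hdir.2.1, hc]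

/-- The case distinction of Phase 1: if `t = 0`, then the first auxiliary equation is `⟪c, x⟫ = -w`. -/
lemma phase1_trichotomy {A : PiLp 2 E →ₗ[ℝ] Y} {c : PiLp 2 E} {F : Set (PiLp 2 E)}
    {q : AuxPoint (PiLp 2 E) Y} (hq : Phase1Solution A c F q) :
    (q.t = 0 ∧ ⟪c, q.x⟫ < 0) ∨ (q.t = 0 ∧ ⟪c, q.x⟫ = 0) ∨ 0 < q.t := by
  obtain ⟨e, es, -, hopt⟩ := hq
  obtain ⟨-, -, -, -, ht, hw⟩ := hopt.1
  rcases ht.eq_or_lt' with ht | ht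
  · have h1 := (hopt.1.ker_of_t_eq_zero ht).2
    rcases hw.eq_or_lt' with hw | hw
    · exact Or.inr (Or.inl ⟨ht, by rw [h1, hw, neg_zero]⟩)
    · exact Or.inl ⟨ht, by linarith⟩
  · exact Or.inr (Or.inr ht)

lemma isPPSSlack_of_phase1Solution {A : PiLp 2 E →ₗ[ℝ] Y} {c : PiLp 2 E}
    {L : ∀ j, ProperCone ℝ (E j)} {q : AuxPoint (PiLp 2 E) Y}
    (hq : Phase1Solution A c (prodCone L) q) (ht : 0 < q.t) :
    IsPPSSlack A c (prodCone L) (auxSlack A c q) := by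
  obtain ⟨e, es, hpar, hopt⟩ := hq
  have hty : q.t = q.y₂ := IsAuxOptimal.t_eq_y₂ (F := prodPC L) hpar.isSlaterPoint hpar.1 hopt
  have hd := hopt.2.2.1
  have hy₂ : 0 < q.y₂ := hty ▸ ht
  have hy₁ : 0 < q.y₁ := by linarith [hd.2.2]
  have hs : q.y₁⁻¹ • (q.y₁ • c - q.y₂ • e - adj A q.y₃) ∈ prodPC L :=
    cone_smul_mem (prodPC L).toPointedCone hd.1 (inv_nonneg.2 hy₁.le)
  have heq := auxSlack_eq (A := A) (c := c) (e := e) hy₁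
  refine ⟨⟨?_, _, rfl⟩, fun j hj => ?_⟩
  · rw [heq]
    exact (prodPC L).toPointedCone.add_mem hs
      (cone_smul_mem (prodPC L).toPointedCone hpar.mem (by positivity))
  · have hej := (hpar.2 j).2 hj
    rw [block_prodCone] at hej ⊢
    rw [heq, PiLp.add_apply, PiLp.smul_apply _ _ e]
    exact add_mem_intrinsicInterior_cone (L j).toPointedCone (hs j)
      (smul_mem_intrinsicInterior_cone (L j).toPointedCone hej (by positivity))

/-- What Phase 1 guarantees when it stops with a face. -/
lemma Phase1StopsFeasible.spec {A : PiLp 2 E →ₗ[ℝ] Y} {c : PiLp 2 E} {K : ∀ j, ProperCone ℝ (E j)}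
    {ds : List (PiLp 2 E)} {F : Set (PiLp 2 E)} {s' : PiLp 2 E}
    (h : Phase1StopsFeasible A c (prodCone K) ds F s') :
    (slacks A c (prodCone K)).Nonempty ∧ minFace (prodCone K) (slacks A c (prodCone K)) ⊆ F ∧
      IsPPSSlack A c F s' ∧ ∀ b, StrongDualityRestored A b c (prodCone K) F := by
  obtain ⟨hreach, q, hq, ht, rfl⟩ := h
  obtain ⟨-, L, rfl, hface, -, hslack⟩ := hreach.invariant
  have hpps := isPPSSlack_of_phase1Solution hq ht
  have heq : slacks A c (prodCone K) = slacks A c (prodCone L) := slacks_congr hslack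
  refine ⟨heq ▸ ⟨_, hpps.1⟩, Set.sInter_subset_of_mem ⟨hface, fun s hs => ?_⟩, hpps, fun b => ?_⟩
  · rw [heq] at hs
    exact hs.1
  · refine strongDualityRestored_of_isSlaterPoint A b c (prodPC L).toPointedCone
      (y₀ := q.y₁⁻¹ • q.y₃) (isSlaterPoint_prodCone L hpps.1.1 fun j hj => ?_) hslack
    have := hpps.2 j
    rw [block_prodCone] at this
    exact this hj

lemma Phase1StopsInfeasible.isInfeasDirection {A : PiLp 2 E →ₗ[ℝ] Y} {c : PiLp 2 E}
    {K : Set (PiLp 2 E)} {ds : List (PiLp 2 E)} {F : Set (PiLp 2 E)} {d : PiLp 2 E}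
    (h : Phase1StopsInfeasible A c K ds F d) : IsInfeasDirection A c F d := by
  obtain ⟨-, q, ⟨e, es, -, hopt⟩, ht, hc, rfl⟩ := h
  exact ⟨hopt.1.2.2.2.1, (hopt.1.ker_of_t_eq_zero ht).1, hc⟩

/-- What Phase 1 guarantees when it reports infeasibility. -/
lemma Phase1StopsInfeasible.spec {A : PiLp 2 E →ₗ[ℝ] Y} {c : PiLp 2 E}
    {K : ∀ j, ProperCone ℝ (E j)} {ds : List (PiLp 2 E)} {F : Set (PiLp 2 E)} {d : PiLp 2 E}
    (h : Phase1StopsInfeasible A c (prodCone K) ds F d) :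
    slacks A c (prodCone K) = ∅ ∧
      ∀ b, (primalFeasible A b F).Nonempty → StrongDualityRestored A b c (prodCone K) F := by
  have hdir := h.isInfeasDirection
  obtain ⟨-, L, rfl, -, -, hslack⟩ := h.1.invariant
  have hempty : slacks A c (prodCone K) = ∅ := by
    rw [slacks_congr hslack]
    exact slacks_eq_empty_of_direction hdir
  exact ⟨hempty, fun b hb => strongDualityRestored_of_infeasible A b c (prodPC L).toPointedCone
    hdir.1 hdir.2.1 hdir.2.2 hempty hb⟩

/-- Phase 1 terminates: each replacement decreases the total distance to polyhedrality. -/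
lemma exists_phase1_stop (A : PiLp 2 E →ₗ[ℝ] Y) (c : PiLp 2 E) (K : ∀ j, ProperCone ℝ (E j)) :
    ∃ ds F, (∃ s', Phase1StopsFeasible A c (prodCone K) ds F s') ∨
      ∃ d, Phase1StopsInfeasible A c (prodCone K) ds F d := by
  have key : ∀ n ds F, Phase1Reaches A c (prodCone K) ds F →
      ∑ j, distPoly (K j : Set (E j)) - ds.length < n →
      ∃ ds F, (∃ s', Phase1StopsFeasible A c (prodCone K) ds F s') ∨
        ∃ d, Phase1StopsInfeasible A c (prodCone K) ds F d := by
    intro n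
    induction n with
    | zero => intro ds F _ h; exact absurd h (Nat.not_lt_zero _)
    | succ n ih =>
      intro ds F hreach hn
      obtain ⟨-, L, rfl, -, -, -⟩ := hreach.invariant
      obtain ⟨e, es, hpar⟩ := exists_phase1Params L
      obtain ⟨q, hopt, -⟩ := exists_isAuxOptimal A c (prodPC L) hpar.isSlaterPoint hpar.1
      have hq : Phase1Solution A c (prodCone L) q := ⟨e, es, hpar, hopt⟩
      rcases phase1_trichotomy hq with ⟨ht, hc⟩ | ⟨ht, hc⟩ | ht
      · exact ⟨ds, _, Or.inr ⟨_, hreach, q, hq, ht, hc, rfl⟩⟩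
      · have hnext := hreach.step hq ht hc
        refine ih _ _ hnext ?_
        obtain ⟨-, L', -, -, hlen, -⟩ := hnext.invariant
        rw [List.length_append, List.length_singleton] at hlen ⊢
        omega
      · exact ⟨ds, _, Or.inl ⟨_, hreach, q, hq, ht, rfl⟩⟩
  exact key _ [] _ .start (Nat.lt_succ_self _)

/-! ### Phase 2 -/

lemma exists_phase2Params (L : ∀ j, ProperCone ℝ (E j)) :
    ∃ e es, Phase2Params (prodCone L) e es := by
  unfold Phase2Params
  rw [relaxedCone_prodCone]
  obtain ⟨e, he⟩ := Set.Nonempty.intrinsicInterior (prodPC (relaxedBlock L)).convex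
    (prodPC (relaxedBlock L)).nonempty
  obtain ⟨es, hes⟩ := Set.Nonempty.intrinsicInterior (dualPC (prodCone (relaxedBlock L))).convex
    ⟨0, (dualPC (prodCone (relaxedBlock L))).zero_mem⟩
  exact ⟨e, es, he, hes⟩

lemma exists_phase2_isAuxStrict (A : PiLp 2 E →ₗ[ℝ] Y) (c : PiLp 2 E)
    (L : ∀ j, ProperCone ℝ (E j)) {e es : PiLp 2 E} (h : Phase2Params (prodCone L) e es) :
    ∃ q, IsAuxStrict A c (relaxedCone (prodCone L)) e es q := by
  unfold Phase2Params at h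
  rw [relaxedCone_prodCone] at h ⊢
  exact exists_isAuxStrict A c (prodPC (relaxedBlock L))
    (isPolyhedral_prodCone _ (isPolyhedral_relaxedBlock L)) (intrinsicInterior_subset h.1) h.2

/-- Combination of the two slacks: in a block where `v` is a relative interior point, all points
`(1 - ε) u + ε v` are; in a block where `u` is a relative interior point and `v` lies in the span,
they are for small `ε`. -/
lemma exists_segment_mem_intrinsicInterior (G : ∀ j, ProperCone ℝ (E j)) {u v : PiLp 2 E}
    (hu : u ∈ prodCone G)
    (h : ∀ j, v j ∈ intrinsicInterior ℝ (G j : Set (E j)) ∨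
      (u j ∈ intrinsicInterior ℝ (G j : Set (E j)) ∧
        v j ∈ Submodule.span ℝ (G j : Set (E j)))) :
    ∃ s ∈ segment ℝ v u, s ∈ intrinsicInterior ℝ (prodCone G) := by
  have key : ∀ j, ∃ ε : ℝ, 0 < ε ∧ ∀ δ : ℝ, 0 < δ → δ ≤ ε → δ < 1 →
      δ • v j + (1 - δ) • u j ∈ intrinsicInterior ℝ (G j : Set (E j)) := by
    intro j
    rcases h j with hv | ⟨huj, hv⟩
    · refine ⟨1, one_pos, fun δ hδ _ hδ1 => ?_⟩
      rw [add_comm]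
      exact add_mem_intrinsicInterior_cone (G j).toPointedCone
        (cone_smul_mem (G j).toPointedCone (hu j) (sub_nonneg.2 hδ1.le))
        (smul_mem_intrinsicInterior_cone (G j).toPointedCone hv hδ)
    · obtain ⟨ε, hε, hmem⟩ := exists_add_smul_mem_of_mem_span (G j).toPointedCone huj hv
      refine ⟨ε / (2 + 2 * ε), by positivity, fun δ hδ hle _ => ?_⟩
      rw [le_div_iff₀ (by positivity)] at hle
      -- `δ v + (1 - δ) u = (δ / ε) (u + ε v) + (1 - δ - δ / ε) u`
      have h1 : δ • v j + (1 - δ) • u j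
          = (δ / ε) • (u j + ε • v j) + (1 - δ - δ / ε) • u j := by
        have h2 : δ = δ / ε * ε := (div_mul_cancel₀ _ hε.ne').symm
        have h3 : δ • v j = (δ / ε * ε) • v j := by rw [← h2]
        rw [h3]
        module
      have h4 : 0 < 1 - δ - δ / ε := by
        have h5 : δ / ε * ε = δ := div_mul_cancel₀ _ hε.ne'
        have h6 : 0 < δ / ε := by positivity
        have h7 : δ / ε * (2 + 2 * ε) ≤ 1 := by
          rw [div_mul_eq_mul_div, div_le_one hε]
          exact hle
        nlinarith
      rw [h1]
      exact add_mem_intrinsicInterior_cone (G j).toPointedCone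
        (cone_smul_mem (G j).toPointedCone hmem (by positivity))
        (smul_mem_intrinsicInterior_cone (G j).toPointedCone huj h4)
  choose ε hε hmem using key
  obtain ⟨δ, hδ, hδle⟩ := exists_pos_forall_le ε hε
  have h0 : 0 < min δ (1 / 2) := by positivity
  have h1 : min δ (1 / 2) < 1 := lt_of_le_of_lt (min_le_right _ _) (by norm_num)
  refine ⟨min δ (1 / 2) • v + (1 - min δ (1 / 2)) • u,
    ⟨_, _, h0.le, sub_nonneg.2 h1.le, by ring, rfl⟩,
    (mem_intrinsicInterior_prodCone G).2 fun j => ?_⟩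
  exact hmem j _ h0 ((min_le_left _ _).trans (hδle j)) h1

lemma exists_eq_sub_adj_of_mem_segment (A : PiLp 2 E →ₗ[ℝ] Y) (c : PiLp 2 E) {y y' : Y} {s : PiLp 2 E}
    (hs : s ∈ segment ℝ (c - adj A y) (c - adj A y')) : ∃ z, s = c - adj A z := by
  obtain ⟨a, b, -, -, hab, rfl⟩ := hs
  refine ⟨a • y + b • y', ?_⟩
  have h1 : c = (a + b) • c := by rw [hab, one_smul]
  rw [map_add, map_smul, map_smul]
  nth_rewrite 3 [h1]
  module

/-- Correctness of Phase 2: some convex combination of `s̃` and `s'` is a feasible slack in the relative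
interior of the final face, and a solution with `t = 0` is a proper direction. -/
lemma phase2_spec {A : PiLp 2 E →ₗ[ℝ] Y} {c : PiLp 2 E} {L : ∀ j, ProperCone ℝ (E j)}
    {s' : PiLp 2 E} (hs' : IsPPSSlack A c (prodCone L) s') {q : AuxPoint (PiLp 2 E) Y}
    (hq : Phase2Solution A c (prodCone L) q) :
    (q.t = 0 ∧ IsProperDirection A c (prodCone L) q.x ∧
      ∃ s ∈ segment ℝ (auxSlack A c q) s', s ∈ slacks A c (prodCone L ∩ perp {q.x}) ∧
        s ∈ intrinsicInterior ℝ (prodCone L ∩ perp {q.x})) ∨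
    (0 < q.t ∧ ∃ s ∈ segment ℝ (auxSlack A c q) s', s ∈ slacks A c (prodCone L) ∧
        s ∈ intrinsicInterior ℝ (prodCone L)) := by
  obtain ⟨e, es, hpar, hopt, hty, hri, hσ, hwy⟩ := hq
  obtain ⟨⟨hsL, y', rfl⟩, hs'ri⟩ := hs'
  simp only [block_prodCone] at hs'ri
  unfold Phase2Params at hpar
  rw [relaxedCone_prodCone] at hpar hopt hri
  have heM := fun j => relaxedBlock_subset_span L j
    ((intrinsicInterior_subset hpar.1 : e ∈ prodCone (relaxedBlock L)) j)
  have hxM : q.x ∈ dualCone (prodCone (relaxedBlock L)) := hopt.1.2.2.2.1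
  have hxL : q.x ∈ dualCone (prodCone L) :=
    dualCone_anti (U := prodCone L) (fun s hs j => le_relaxedBlock L j (hs j)) hxM
  rcases hopt.1.2.2.2.2.1.eq_or_lt' with ht | ht
  · left
    obtain ⟨hA, hcx⟩ := hopt.1.ker_of_t_eq_zero ht
    -- the feasible slack `s'` forces `⟪c, x⟫ = 0`
    have hcx0 : 0 ≤ ⟪c, q.x⟫ := by
      have h1 := hxL hsL
      rwa [innerₗ_apply_apply, real_inner_comm, inner_slack_of_ker hA] at h1
    have hw : q.w = 0 := by linarith [hopt.1.2.2.2.2.2]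
    have hc0 : ⟪c, q.x⟫ = 0 := by rw [hcx, hw, neg_zero]
    have hy₂ : q.y₂ = 0 := hty.symm.trans ht
    have hy₁ : 0 < q.y₁ := by linarith
    have hex : ⟪e, q.x⟫ = 1 := by
      have := hopt.1.2.1
      linarith
    have hslack : ∀ y, c - adj A y ∈ perp {q.x} := fun y => by
      rw [mem_perp_singleton, inner_slack_of_ker hA, hc0]
    have hsec := prodCone_inter_perp L hxL
    refine ⟨ht, ⟨hxL, hA, fun h => ?_, hc0⟩, ?_⟩
    · -- `x` would be orthogonal to the span of each block, hence to `e`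
      have h1 : ⟪e, q.x⟫ = 0 := by
        rw [PiLp.inner_apply]
        refine Finset.sum_eq_zero fun j _ => ?_
        have h2 : q.x j ∈ (Submodule.span ℝ (L j : Set (E j)))ᗮ := by
          rw [Submodule.mem_orthogonal]
          intro u hu
          induction hu using Submodule.span_induction with
          | mem v hv => rw [← h _ (blockSingle_mem_prodCone L hv), inner_blockSingle]
          | zero => exact inner_zero_left _
          | add u v _ _ hu hv => rw [inner_add_left, hu, hv, add_zero]
          | smul a u _ hu => rw [real_inner_smul_left, hu, mul_zero]
        exact Submodule.inner_right_of_mem_orthogonal (heM j) h2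
      linarith
    · -- `s̃` lies in the relative interior of the face of the relaxed cone exposed by `x`
      have hst : auxSlack A c q
          ∈ intrinsicInterior ℝ (prodCone fun j => hyperplaneSection (relaxedBlock L j) (q.x j)) := by
        rw [← prodCone_inter_perp _ hxM, auxSlack_eq (e := e) hy₁,
          show q.y₁⁻¹ * q.y₂ = 0 by rw [hy₂, mul_zero], zero_smul, add_zero]
        exact smul_mem_intrinsicInterior_cone
          (hyperplaneSection (prodPC (relaxedBlock L)) q.x).toPointedCone hri (inv_pos.2 hy₁)
      rw [mem_intrinsicInterior_prodCone] at hst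
      rw [hsec]
      have hu : c - adj A y' ∈ prodCone fun j => hyperplaneSection (L j) (q.x j) := by
        rw [← hsec]
        exact ⟨hsL, hslack y'⟩
      obtain ⟨s, hs, hsri⟩ := exists_segment_mem_intrinsicInterior _ (v := auxSlack A c q) hu
        fun j => by
          by_cases hp : IsPolyhedral (L j : Set (E j))
          · left
            have := hst j
            rwa [relaxedBlock_of_isPolyhedral L hp] at this
          · right
            -- `x j` is orthogonal to the whole block, which is not changed by the step
            have hLj : (hyperplaneSection (L j) (q.x j) : Set (E j)) = L j := by
              refine Set.inter_eq_left.2 fun v hv => ?_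
              have hmem : ∀ v ∈ Submodule.span ℝ (L j : Set (E j)), 0 ≤ ⟪v, q.x j⟫ := by
                intro v hv
                have h1 := (mem_dualCone_prodCone _).1 hxM j
                rw [relaxedBlock_of_not_isPolyhedral L hp] at h1
                exact h1 hv
              have h1 := hmem v (Submodule.subset_span hv)
              have h2 := hmem (-v) (Submodule.neg_mem _ (Submodule.subset_span hv))
              rw [inner_neg_left] at h2
              rw [mem_perp_singleton, real_inner_comm]
              linarith
            rw [hLj]
            refine ⟨hs'ri j hp, ?_⟩
            have h1 : auxSlack A c q j ∈ hyperplaneSection (relaxedBlock L j) (q.x j) :=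
              intrinsicInterior_subset (hst j)
            exact relaxedBlock_subset_span L j h1.1
      exact ⟨s, hs, ⟨intrinsicInterior_subset hsri, exists_eq_sub_adj_of_mem_segment A c hs⟩, hsri⟩
  · right
    have hy₂ : 0 < q.y₂ := hty ▸ ht
    have hd := hopt.2.2.1
    have hy₁ : 0 < q.y₁ := by linarith [hd.2.2]
    -- `s̃` lies in the relative interior of the relaxed cone
    have hst : auxSlack A c q ∈ intrinsicInterior ℝ (prodCone (relaxedBlock L)) := by
      rw [auxSlack_eq (e := e) hy₁]
      exact add_mem_intrinsicInterior_cone (prodPC (relaxedBlock L)).toPointedCone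
        (cone_smul_mem (prodPC (relaxedBlock L)).toPointedCone hd.1 (inv_nonneg.2 hy₁.le))
        (smul_mem_intrinsicInterior_cone (prodPC (relaxedBlock L)).toPointedCone hpar.1
          (by positivity))
    rw [mem_intrinsicInterior_prodCone] at hst
    obtain ⟨s, hs, hsri⟩ := exists_segment_mem_intrinsicInterior L (v := auxSlack A c q) hsL
      fun j => by
        by_cases hp : IsPolyhedral (L j : Set (E j))
        · left
          have := hst j
          rwa [relaxedBlock_of_isPolyhedral L hp] at this
        · exact Or.inr ⟨hs'ri j hp,
            relaxedBlock_subset_span L j (intrinsicInterior_subset (hst j))⟩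
    exact ⟨ht, s, hs, ⟨intrinsicInterior_subset hsri, exists_eq_sub_adj_of_mem_segment A c hs⟩, hsri⟩

lemma exists_phase2Output {A : PiLp 2 E →ₗ[ℝ] Y} {c : PiLp 2 E} {L : ∀ j, ProperCone ℝ (E j)}
    {s' : PiLp 2 E} (hs' : IsPPSSlack A c (prodCone L) s') {q : AuxPoint (PiLp 2 E) Y}
    (hq : Phase2Solution A c (prodCone L) q) (ds : List (PiLp 2 E)) :
    ∃ ds' G, Phase2Output ds (prodCone L) q ds' G ∧ ∃ s ∈ segment ℝ (auxSlack A c q) s',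
      s ∈ slacks A c G ∧ s ∈ intrinsicInterior ℝ G := by
  rcases phase2_spec hs' hq with ⟨ht, -, h⟩ | ⟨ht, h⟩
  · exact ⟨_, _, .reduce ht, h⟩
  · exact ⟨_, _, .keep ht, h⟩

/-! ### Complete runs -/

lemma exists_fraPolyOutput (A : PiLp 2 E →ₗ[ℝ] Y) (c : PiLp 2 E) (K : ∀ j, ProperCone ℝ (E j)) :
    ∃ ds G, FRAPolyOutput A c (prodCone K) ds G := by
  obtain ⟨ds, F, ⟨s', h⟩ | ⟨d, h⟩⟩ := exists_phase1_stop A c K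
  · have hpps := h.spec.2.2.1
    obtain ⟨-, L, rfl, -⟩ := h.1.invariant
    obtain ⟨e, es, hpar⟩ := exists_phase2Params L
    obtain ⟨q, hq⟩ := exists_phase2_isAuxStrict A c L hpar
    have hq' : Phase2Solution A c (prodCone L) q := ⟨e, es, hpar, hq⟩
    obtain ⟨ds', G, hout, -⟩ := exists_phase2Output hpps hq' ds
    exact ⟨ds', G, .feasible h hq' hout⟩
  · exact ⟨_, _, .infeasible h⟩

/-- A face reached by facial reduction steps that has a feasible slack in its relative interior is the
minimal face, and an output of the generic algorithm. -/
lemma minFace_and_genericOutput {A : PiLp 2 E →ₗ[ℝ] Y} {c : PiLp 2 E}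
    {K G : ∀ j, ProperCone ℝ (E j)} {ds : List (PiLp 2 E)} (hface : IsFace (prodCone K) (prodCone G))
    (hslack : slacks A c (prodCone K) = slacks A c (prodCone G))
    (hred : ReducesTo A c (prodCone K) ds (prodCone G)) {s : PiLp 2 E}
    (hs : s ∈ slacks A c (prodCone G)) (hri : s ∈ intrinsicInterior ℝ (prodCone G)) :
    prodCone G = minFace (prodCone K) (slacks A c (prodCone K)) ∧
      GenericOutput A c (prodCone K) ds (prodCone G) := by
  refine ⟨?_, .minimal hred
    (no_direction_of_mem_intrinsicInterior (prodPC G).toPointedCone hs hri)⟩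
  rw [hslack]
  exact (minFace_eq_of_mem_intrinsicInterior (prodPC K).toPointedCone (prodPC G).toPointedCone hface
    (fun s hs => hs.1) hs hri).symm

theorem FRAPolyOutput.spec {A : PiLp 2 E →ₗ[ℝ] Y} {c : PiLp 2 E} {K : ∀ j, ProperCone ℝ (E j)}
    {ds : List (PiLp 2 E)} {G : Set (PiLp 2 E)} (h : FRAPolyOutput A c (prodCone K) ds G) :
    G = minFace (prodCone K) (slacks A c (prodCone K)) ∧ GenericOutput A c (prodCone K) ds G ∧
      ds.length ≤ 1 + ∑ j, distPoly (K j : Set (E j)) := by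
  cases h with
  | infeasible h =>
    obtain ⟨hred, L, -, -, hlen, -⟩ := h.1.invariant
    refine ⟨?_, .infeasible hred h.isInfeasDirection, ?_⟩
    · rw [h.spec.1]
      have hface : IsFace (prodCone K) ∅ :=
        ⟨⟨Set.empty_subset _, fun _ _ _ _ _ hz => hz.elim⟩, convex_empty⟩
      have hmem : (∅ : Set (PiLp 2 E)) ∈ {F | IsFace (prodCone K) F ∧ ∅ ⊆ F} := ⟨hface, subset_rfl⟩
      exact (Set.subset_empty_iff.1 (Set.sInter_subset_of_mem hmem)).symm
    · rw [List.length_append, List.length_singleton]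
      omega
  | feasible h hq hout =>
    have hpps := h.spec.2.2.1
    obtain ⟨hred, L, rfl, hface, hlen, hslack⟩ := h.1.invariant
    rcases phase2_spec hpps hq with ⟨ht, hdir, s, -, hs, hri⟩ | ⟨ht, s, -, hs, hri⟩
    · cases hout with
      | keep h0 => exact absurd ht h0.ne'
      | reduce _ =>
        have hsec := prodCone_inter_perp L hdir.1
        have hred' := hred.step hdir
        have hface' : IsFace (prodCone K) (prodCone L ∩ perp {_}) :=
          hface.trans (isFace_inter_perp (prodPC L).toPointedCone hdir.1)
        have hslack' : slacks A c (prodCone K) = slacks A c (prodCone L ∩ perp {_}) :=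
          slacks_congr fun y => (hslack y).trans ⟨fun h => ⟨h, by
            rw [mem_perp_singleton, inner_slack_of_ker hdir.2.1, hdir.2.2.2]⟩, fun h => h.1⟩
        rw [hsec] at hs hri hred' hface' hslack' ⊢
        obtain ⟨h1, h2⟩ := minFace_and_genericOutput hface' hslack' hred' hs hri
        refine ⟨h1, h2, ?_⟩
        rw [List.length_append, List.length_singleton]
        omega
    · cases hout with
      | reduce h0 => exact absurd h0 ht.ne'
      | keep _ =>
        obtain ⟨h1, h2⟩ := minFace_and_genericOutput hface (slacks_congr hslack) hred hs hri
        exact ⟨h1, h2, by omega⟩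

theorem distStrongDuality_le (A : PiLp 2 E →ₗ[ℝ] Y) (b : Y) (c : PiLp 2 E)
    (K : ∀ j, ProperCone ℝ (E j))
    (hb : (primalFeasible A b (prodCone K)).Nonempty ∨ (slacks A c (prodCone K)).Nonempty) :
    distStrongDuality A b c (prodCone K) ≤ ((∑ j, distPoly (K j : Set (E j)) : ℕ) : ℕ∞) := by
  have hle : ∀ ds F, Phase1Reaches A c (prodCone K) ds F →
      StrongDualityRestored A b c (prodCone K) F →
      distStrongDuality A b c (prodCone K) ≤ ((∑ j, distPoly (K j : Set (E j)) : ℕ) : ℕ∞) := by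
    intro ds F hreach hsd
    obtain ⟨hred, L, -, -, hlen, -⟩ := hreach.invariant
    exact (iInf₂_le ds ⟨F, hred, hsd⟩).trans (by exact_mod_cast (by omega))
  obtain ⟨ds, F, ⟨s', h⟩ | ⟨d, h⟩⟩ := exists_phase1_stop A c K
  · exact hle ds F h.1 (h.spec.2.2.2 b)
  · obtain ⟨hempty, hsd⟩ := h.spec
    obtain ⟨x, hx⟩ := hb.resolve_right (by rw [hempty]; exact Set.not_nonempty_empty)
    obtain ⟨-, L, rfl, hface, -⟩ := h.1.invariant
    exact hle ds _ h.1 (hsd b ⟨x, hx.1, dualCone_anti hface.1.subset hx.2⟩)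

end Poly

end FacialReduction

end

open FacialReduction in
theorem mainTheorem1 {r : ℕ} {E : Fin r → Type*} [∀ j, NormedAddCommGroup (E j)]
    [∀ j, InnerProductSpace ℝ (E j)] [∀ j, FiniteDimensional ℝ (E j)]
    {Y : Type*} [NormedAddCommGroup Y] [InnerProductSpace ℝ Y] [FiniteDimensional ℝ Y]
    (A : PiLp 2 E →ₗ[ℝ] Y) (c : PiLp 2 E) (K : ∀ j, ProperCone ℝ (E j)) :
    -- Phase 1 can always continue, and it performs a bounded number of reductions.
    (∀ ds F, Phase1Reaches A c (prodCone K) ds F →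
      ds.length ≤ ∑ j, distPoly (K j : Set (E j)) ∧
      (∃ e es, Phase1Params F e es) ∧
      (∀ e es, Phase1Params F e es → ∃ q, IsAuxOptimal A c F e es q) ∧
      (∀ q, Phase1Solution A c F q →
        (q.t = 0 ∧ ⟪c, q.x⟫ < 0) ∨ (q.t = 0 ∧ ⟪c, q.x⟫ = 0) ∨ 0 < q.t)) ∧
    -- Phase 1 stops with a face only if (D) is feasible; that face restores strong duality.
    (∀ ds F s', Phase1StopsFeasible A c (prodCone K) ds F s' →
      (slacks A c (prodCone K)).Nonempty ∧
      minFace (prodCone K) (slacks A c (prodCone K)) ⊆ F ∧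
      IsPPSSlack A c F s' ∧
      (∀ b, StrongDualityRestored A b c (prodCone K) F)) ∧
    -- Phase 1 reports infeasibility only if (D) is infeasible; its last face restores strong
    -- duality unless the primal problem over that face is infeasible, too.
    (∀ ds F d, Phase1StopsInfeasible A c (prodCone K) ds F d →
      slacks A c (prodCone K) = ∅ ∧
      (∀ b, (primalFeasible A b F).Nonempty → StrongDualityRestored A b c (prodCone K) F)) ∧
    -- Phase 2 can always be carried out.
    (∀ ds F s', Phase1StopsFeasible A c (prodCone K) ds F s' →
      (∃ e es, Phase2Params F e es) ∧
      (∀ e es, Phase2Params F e es → ∃ q, IsAuxStrict A c (relaxedCone F) e es q) ∧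
      (∀ q, Phase2Solution A c F q →
        ∃ ds' G, Phase2Output ds F q ds' G ∧
          ∃ s ∈ segment ℝ (auxSlack A c q) s', s ∈ slacks A c G ∧ s ∈ intrinsicInterior ℝ G)) ∧
    -- Complete runs exist, and each one finds the minimal face within the bound.
    (∃ ds G, FRAPolyOutput A c (prodCone K) ds G) ∧
    (∀ ds G, FRAPolyOutput A c (prodCone K) ds G →
      G = minFace (prodCone K) (slacks A c (prodCone K)) ∧
      GenericOutput A c (prodCone K) ds G ∧
      ds.length ≤ 1 + ∑ j, distPoly (K j : Set (E j))) ∧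
    -- Consequences for the singularity degree and for the distance to strong duality.
    singularityDegree A c (prodCone K) ≤ ((1 + ∑ j, distPoly (K j : Set (E j)) : ℕ) : ℕ∞) ∧
    (∀ b, (primalFeasible A b (prodCone K)).Nonempty ∨ (slacks A c (prodCone K)).Nonempty →
      distStrongDuality A b c (prodCone K) ≤ ((∑ j, distPoly (K j : Set (E j)) : ℕ) : ℕ∞)) := by
  refine ⟨fun ds F h => ?_, fun ds F s' h => h.spec, fun ds F d h => h.spec, fun ds F s' h => ?_,
    exists_fraPolyOutput A c K, fun ds G h => h.spec, ?_, fun b hb => distStrongDuality_le A b c K hb⟩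
  · obtain ⟨-, L, rfl, -, hlen, -⟩ := h.invariant
    refine ⟨by omega, exists_phase1Params L, fun e es hpar => ?_, fun q hq => phase1_trichotomy hq⟩
    obtain ⟨q, hq, -⟩ := exists_isAuxOptimal A c (prodPC L) hpar.isSlaterPoint hpar.1
    exact ⟨q, hq⟩
  · have hpps := h.spec.2.2.1
    obtain ⟨-, L, rfl, -⟩ := h.1.invariant
    exact ⟨exists_phase2Params L, fun e es hpar => exists_phase2_isAuxStrict A c L hpar,
      fun q hq => exists_phase2Output hpps hq ds⟩
  · obtain ⟨ds, G, h⟩ := exists_fraPolyOutput A c K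
    obtain ⟨-, hgen, hlen⟩ := h.spec
    exact (iInf₂_le ds ⟨G, hgen⟩).trans (by exact_mod_cast hlen)
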